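/- For functions $f,g:\{0,1\}^n\to G$ let $\delta(f,g)$ be the fraction of points of $\{0,1\}^n$ at which $f$ and $g$ differ. For an Abelian group $G$ and integers $d,n\ge 0$, let $\mathcal{P}_d(\{0,1\}^n,G)$ be the set of functions $P:\{0,1\}^n\to G$ of the form $P(x)=\sum_{I\subseteq[n],\,|I|\le d}\alpha_I\prod_{i\in I}x_i$ with all $\alpha_I\in G$. We consider probabilistic (possibly adaptive, non-uniform in $n$) algorithms with oracle access to a function $f:\{0,1\}^n\to G$ that can store group elements, add and negate them, and compare two of them for equality. Such an algorithm, with a point $\mathbf{a}\in\{0,1\}^n$ as input, is a $(\delta,q)$-local correction algorithm for $\mathcal{P}_d(\{0,1\}^n,G)$ if it makes at most $q$ queries to its oracle and, for every $P\in\mathcal{P}_d(\{0,1\}^n,G)$, every $f:\{0,1\}^n\to G$ with $\delta(f,P)\le\delta$, and every $\mathbf{a}\in\{0,1\}^n$, it outputs $P(\mathbf{a})$ with probability at least $3/4$. **Theorem.** For every $\varepsilon>0$ there are constants $C$ and $c$, depending only on $\varepsilon$, such that for every integer $d\ge 0$ there is a function $q:\mathbb{N}\to\mathbb{N}$ with $$q(n)\le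 C\,(\log n)^d\,\bigl(\log(2+(\log n)^d)\bigr)^{c}\qquad\text{for all } n\ge 2,$$ that is, $q(n)=\widetilde{O}_\varepsilon((\log n)^d)$, such that for every Abelian group $G$ and every $n\ge 0$ the space $\mathcal{P}_d(\{0,1\}^n,G)$ has a $(\delta,q(n))$-local correction algorithm with $\delta=\frac{1}{2^{d+1}}-\varepsilon$. -/

import Mathlib

namespace LocalCorrection

/-- Points of the Boolean cube `{0,1}^n`. -/
abbrev Cube (n : ℕ) : Type := Fin n → Bool

/-- The space of functions `{0,1}^n → G` that are multilinear polynomials of degree at most `d`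
with coefficients in the Abelian group `G`: sums over `I ⊆ [n]`, `|I| ≤ d`, of
`α_I ∏_{i ∈ I} x_i`, where the product is taken over the integers. -/
def polySpace (d n : ℕ) (G : Type*) [AddCommGroup G] : Set (Cube n → G) :=
  {P | ∃ α : Finset (Fin n) → G, ∀ x : Cube n,
    P x = ∑ I ∈ Finset.univ.filter (fun I : Finset (Fin n) => I.card ≤ d),
      (∏ i ∈ I, (x i).toNat) • α I}

/-- The fraction of points of the cube at which `f` and `g` differ. -/
noncomputable def relDist {n : ℕ} {G : Type*} (f g : Cube n → G) : ℝ :=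
  ({x : Cube n | f x ≠ g x}.ncard : ℝ) / 2 ^ n

/-- Deterministic adaptive algorithms with oracle access to a function `{0,1}^n → G`, for an
Abelian group `G` whose elements can be stored, added, negated and compared for equality.
`OracleProgram n m` is the type of (rests of) such algorithms when `m` oracle answers have been
stored so far. The group elements obtainable from stored elements by the group operations are
exactly their integer combinations, so an algorithm either outputs an integer combination of the
stored answers, or queries the oracle at a point and stores the answer, or branches according to
whether an integer combination of the stored answers is zero (that is, whether two group elements
that it has computed are equal). -/
inductive OracleProgram (n : ℕ) : ℕ → Type
  | output {m : ℕ} (c : Fin m → ℤ) : OracleProgram n m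
  | query {m : ℕ} (x : Cube n) (next : OracleProgram n (m + 1)) : OracleProgram n m
  | branch {m : ℕ} (c : Fin m → ℤ) (ifZero ifNonzero : OracleProgram n m) : OracleProgram n m

namespace OracleProgram

open Classical in
/-- The output with oracle `f`, when `r` lists the answers stored so far (latest first). -/
noncomputable def eval {n : ℕ} {G : Type*} [AddCommGroup G] (f : Cube n → G) :
    {m : ℕ} → OracleProgram n m → (Fin m → G) → G
  | _, output c, r => ∑ i, c i • r i
  | _, query x next, r => eval f next (Fin.cons (f x) r)
  | _, branch c ifZero ifNonzero, r =>
      if ∑ i, c i • r i = 0 then eval f ifZero r else eval f ifNonzero r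

/-- The output of a whole algorithm, started with empty storage, with oracle `f`. -/
noncomputable def run {n : ℕ} {G : Type*} [AddCommGroup G] (f : Cube n → G)
    (p : OracleProgram n 0) : G :=
  p.eval f Fin.elim0

/-- The largest number of oracle queries along a computation path. -/
def queries {n : ℕ} : {m : ℕ} → OracleProgram n m → ℕ
  | _, output _ => 0
  | _, query _ next => queries next + 1
  | _, branch _ ifZero ifNonzero => max (queries ifZero) (queries ifNonzero)

end OracleProgram

/-- `F` has a `(δ, q)`-local correction algorithm. A probabilistic algorithm is given, for each
input point `a`, by a probability distribution on deterministic oracle algorithms (the random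
choices are made at the start, independently of the oracle). It makes at most `q` queries, and
whenever the oracle `f` is `δ`-close to `P ∈ F`, it outputs `P a` with probability at
least `3/4`, for every `a`. -/
def HasLocalCorrection {n : ℕ} {G : Type*} [AddCommGroup G]
    (F : Set (Cube n → G)) (δ : ℝ) (q : ℕ) : Prop :=
  ∃ A : Cube n → PMF (OracleProgram n 0),
    (∀ a, ∀ p ∈ (A a).support, p.queries ≤ q) ∧
    ∀ f : Cube n → G, ∀ P ∈ F, relDist f P ≤ δ →
      ∀ a : Cube n, 3 / 4 ≤ ((A a).map (OracleProgram.run f)) (P a)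

end LocalCorrection

namespace LocalCorrection

open Finset BigOperators

/-! A map `h` from the `n` coordinates to a small set `κ` places a small cube through each point
`x`, by `y ↦ x ⊕ (y ∘ h)`, and functions of degree `d` restrict to functions of degree `d` on it.
Correction combines three uses of such cubes with random `h`.

Final step. Suppose `f'` differs from `P` on much less than a `1/m` fraction of points. Put the
origin of a cube at `a` and write `P a` as an integer combination of the values at `m` nearly
balanced points of that cube. Each of these lands almost uniformly in `{0,1}^n`
(`prob_embedCube_le`), so a union bound suffices. The coordinates carry weights `1, 2, …, 2^r` with
`2^r ≥ n`, and `h` selects a coordinate with probability proportional to its weight. Thus balance to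
accuracy `O(1/n)` costs only `O(log n)` coordinates for fixed `d`.

The balanced values determine the value at the origin by `apply_indVec_empty_of_window`. Trading a
coordinate of weight `2^(i+1)` for two of weight `2^i` preserves total weight, and the resulting
difference of `Q` has lower degree, so by induction the trade does not affect `Q`. Iterated down to
weight one, this shows that adding a coordinate does not affect `Q` below the balanced weight, which
is then reached greedily from the origin. Over `ℤ` a rank bound does not control the number of
points. A count of distinct subset sums (`exists_small_spanning_subset`) gives `m` of order `(log
n)^d` up to a logarithmic factor.

Error reduction. With one `h` shared by all `x`, unique decoding of `f` on the cube through each `x`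
yields a new function. Two points of a random cube are noisy copies of each other with correlation
`bias`, typically of order `K^(-1/2)`. A second-moment bound therefore brings any distance at most
`2^(-d-1) - ε` below a prescribed constant in one round of constant dimension. After that, small-set
expansion turns distance `δ` into `O(δ^(3/2))` per round. Decay is doubly exponential, `O(log log
m)` rounds suffice, and they multiply the number of queries only by a power of `log m`. -/

/-- Sums of functions each of which depends on at most `d` coordinates. -/
def juntaSum (d : ℕ) (κ G : Type*) [AddCommGroup G] : AddSubgroup ((κ → Bool) → G) :=
  AddSubgroup.closure {g | ∃ J : Finset κ, J.card ≤ d ∧ DependsOn g (J : Set κ)}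

/-! ### Functions of degree at most `d` as sums of juntas, and their minimum distance -/

section JuntaSum

variable {κ κ' G : Type*} [AddCommGroup G] {d : ℕ}

lemma mem_juntaSum_of_dependsOn {g : (κ → Bool) → G} {J : Finset κ} (hJ : J.card ≤ d)
    (hg : DependsOn g (J : Set κ)) : g ∈ juntaSum d κ G :=
  AddSubgroup.subset_closure ⟨J, hJ, hg⟩

lemma polySpace_subset_juntaSum {n : ℕ} {P : Cube n → G} (hP : P ∈ polySpace d n G) :
    P ∈ juntaSum d (Fin n) G := by
  obtain ⟨α, hα⟩ := hP
  have : P = ∑ I ∈ univ.filter (fun I : Finset (Fin n) => I.card ≤ d),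
      fun x : Cube n => (∏ i ∈ I, (x i).toNat) • α I := by
    ext x
    rw [hα, Finset.sum_apply]
  rw [this]
  refine AddSubgroup.sum_mem _ fun I hI => mem_juntaSum_of_dependsOn (J := I) (by simpa using hI) ?_
  intro x y hxy
  simp only
  congr 1
  exact prod_congr rfl fun i hi => by rw [hxy i hi]

/-- A junta on `J` becomes a junta on the image of `J` under `h`. The maps `b` allow the coordinate
flips in `embedCube` and the insertion of constants. -/
lemma juntaSum_comp {Q : (κ → Bool) → G} (hQ : Q ∈ juntaSum d κ G) (h : κ → κ')
    (b : κ → Bool → Bool) : (fun z : κ' → Bool => Q fun j => b j (z (h j))) ∈ juntaSum d κ' G := by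
  classical
  induction hQ using AddSubgroup.closure_induction with
  | mem g hg =>
    obtain ⟨J, hJ, hg⟩ := hg
    refine mem_juntaSum_of_dependsOn (J := J.image h) (card_image_le.trans hJ) ?_
    intro x y hxy
    refine hg fun i hi => ?_
    rw [hxy (h i) (by simpa using ⟨i, hi, rfl⟩)]
  | zero => exact AddSubgroup.zero_mem _
  | add x y _ _ hx hy => exact AddSubgroup.add_mem _ hx hy
  | neg x _ hx => exact AddSubgroup.neg_mem _ hx

lemma juntaSum_zero_const {Q : (κ → Bool) → G} (hQ : Q ∈ juntaSum 0 κ G) (x y : κ → Bool) :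
    Q x = Q y := by
  induction hQ using AddSubgroup.closure_induction with
  | mem g hg =>
    obtain ⟨J, hJ, hg⟩ := hg
    refine hg fun i hi => ?_
    simp only [nonpos_iff_eq_zero, card_eq_zero] at hJ
    simp [hJ] at hi
  | zero => rfl
  | add _ _ _ _ h1 h2 => simp [h1, h2]
  | neg _ _ h => simp [h]

/-- Comparing two ways of freezing the coordinates in `J` lowers the degree. -/
lemma juntaSum_sub_freeze [DecidableEq κ] {Q : (κ → Bool) → G} (hQ : Q ∈ juntaSum (d + 1) κ G)
    (J : Finset κ) (u v : κ → Bool) :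
    (fun z : κ → Bool => Q (fun i => if i ∈ J then u i else z i) -
      Q (fun i => if i ∈ J then v i else z i)) ∈ juntaSum d κ G := by
  induction hQ using AddSubgroup.closure_induction with
  | mem g hg =>
    obtain ⟨I, hI, hg⟩ := hg
    by_cases hIJ : Disjoint I J
    · have : (fun z : κ → Bool => g (fun i => if i ∈ J then u i else z i) -
          g (fun i => if i ∈ J then v i else z i)) = 0 := by
        ext z
        rw [Pi.zero_apply, sub_eq_zero]
        refine hg fun i hi => ?_
        have : i ∉ J := Finset.disjoint_left.1 hIJ hi
        simp [this]
      rw [this]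
      exact AddSubgroup.zero_mem _
    · refine mem_juntaSum_of_dependsOn (J := I \ J) ?_ ?_
      · obtain ⟨i, hi, hj⟩ := Finset.not_disjoint_iff.1 hIJ
        have : (I \ J).card < I.card :=
          card_lt_card (ssubset_iff_of_subset sdiff_subset |>.2 ⟨i, hi, by simp [hj]⟩)
        omega
      · intro x y hxy
        simp only
        congr 1 <;>
        · refine hg fun i hi => ?_
          by_cases h : i ∈ J
          · simp [h]
          · simp only [h, if_false]
            exact hxy i (by simpa [h] using hi)
  | zero =>
    simp only [Pi.zero_apply, sub_zero]
    exact AddSubgroup.zero_mem _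
  | add x y _ _ hx hy =>
    have := AddSubgroup.add_mem _ hx hy
    convert this using 1
    ext z
    simp only [Pi.add_apply]
    abel
  | neg x _ hx =>
    have := AddSubgroup.neg_mem _ hx
    convert this using 1
    ext z
    simp only [Pi.neg_apply]
    abel

/-- A nonzero function of degree `d` is nonzero on a `2^{-d}` fraction of the cube. -/
lemma two_pow_le_card_ne_zero {n : ℕ} : ∀ {d : ℕ} {Q : Cube n → G},
    Q ∈ juntaSum d (Fin n) G → Q ≠ 0 → 2 ^ n ≤ 2 ^ d * {x | Q x ≠ 0}.ncard := by
  induction n with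
  | zero =>
    intro d Q _ h0
    obtain ⟨x, hx⟩ := Function.ne_iff.1 h0
    have : 0 < {x | Q x ≠ 0}.ncard := (Set.ncard_pos (Set.toFinite _)).2 ⟨x, hx⟩
    exact Nat.mul_pos (Nat.two_pow_pos d) this
  | succ n ih =>
    intro d Q hQ h0
    have hcons : ∀ b : Bool, (fun z : Cube n => Q (Fin.cons b z)) ∈ juntaSum d (Fin n) G := by
      intro b
      -- The frozen coordinate has to be sent to some coordinate of the smaller cube, so dimension
      -- zero, where all functions are constant, is separate.
      rcases n with _ | n
      · by_cases hd : d = 0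
        · subst hd
          exact mem_juntaSum_of_dependsOn (J := ∅) (by simp)
            (fun x y _ => by rw [Subsingleton.elim x y])
        · exact mem_juntaSum_of_dependsOn (J := ∅) (by simp)
            (fun x y _ => by rw [Subsingleton.elim x y])
      · have := juntaSum_comp hQ (κ' := Fin (n + 1)) (Fin.cons 0 id)
          (Fin.cons (fun _ => b) fun _ => id)
        convert this using 3 with z
        ext i
        refine Fin.cases ?_ (fun i => ?_) i <;> simp
    have hsplit : {x | Q x ≠ 0}.ncard = {z : Cube n | Q (Fin.cons false z) ≠ 0}.ncard +
        {z : Cube n | Q (Fin.cons true z) ≠ 0}.ncard := by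
      have hinj : ∀ b : Bool, Function.Injective (fun z : Cube n => (Fin.cons b z : Cube (n + 1))) :=
        fun b => Fin.cons_right_injective (α := fun _ => Bool) b
      rw [← Set.ncard_image_of_injective _ (hinj false), ← Set.ncard_image_of_injective _ (hinj true),
        ← Set.ncard_union_eq _ (Set.toFinite _) (Set.toFinite _)]
      · congr 1
        ext x
        simp only [Set.mem_ofPred_eq, Set.mem_union, Set.mem_image]
        constructor
        · intro hx
          rw [← Fin.cons_self_tail x] at hx
          rcases hb : x 0 with _ | _
          · left; exact ⟨Fin.tail x, by rwa [hb] at hx, by rw [← hb, Fin.cons_self_tail]⟩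
          · right; exact ⟨Fin.tail x, by rwa [hb] at hx, by rw [← hb, Fin.cons_self_tail]⟩
        · rintro (⟨z, hz, rfl⟩ | ⟨z, hz, rfl⟩) <;> exact hz
      · rw [Set.disjoint_left]
        rintro _ ⟨z, _, rfl⟩ ⟨z', _, h⟩
        have := congrFun h 0
        simp at this
    by_cases hD : ∀ z : Cube n, Q (Fin.cons true z) = Q (Fin.cons false z)
    · have hne : (fun z : Cube n => Q (Fin.cons false z)) ≠ 0 := by
        intro h
        apply h0
        ext x
        rw [← Fin.cons_self_tail x]
        rcases x 0 with _ | _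
        · exact congrFun h _
        · rw [hD]; exact congrFun h _
      have := ih (hcons false) hne
      rw [hsplit]
      simp only [hD]
      rw [pow_succ]
      linarith
    -- Otherwise the derivative in the first coordinate is nonzero and of degree one less; wherever
    -- it is nonzero, one of the two restrictions is nonzero.
    · push Not at hD
      obtain ⟨z₀, hz₀⟩ := hD
      rcases d with _ | d
      · exact absurd (juntaSum_zero_const hQ _ _) hz₀
      have hDm : (fun z : Cube n => Q (Fin.cons true z) - Q (Fin.cons false z)) ∈
          juntaSum d (Fin n) G := by
        rcases n with _ | n
        · exact mem_juntaSum_of_dependsOn (J := ∅) (by simp)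
            (fun x y _ => by rw [Subsingleton.elim x y])
        have h1 := juntaSum_sub_freeze hQ {0} (fun _ => true) (fun _ => false)
        have := juntaSum_comp h1 (κ' := Fin (n + 1)) (Fin.cons 0 id) (fun _ => id)
        convert this using 3 with z
        all_goals
          congr 1
          ext i
          refine Fin.cases ?_ (fun i => ?_) i <;> simp
      have hne : (fun z : Cube n => Q (Fin.cons true z) - Q (Fin.cons false z)) ≠ 0 := by
        intro h
        exact hz₀ (sub_eq_zero.1 (congrFun h z₀))
      have h2 := ih hDm hne
      have h3 : {z : Cube n | Q (Fin.cons true z) - Q (Fin.cons false z) ≠ 0}.ncard ≤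
          {x | Q x ≠ 0}.ncard := by
        rw [hsplit]
        refine (Set.ncard_le_ncard ?_ (Set.toFinite _)).trans (Set.ncard_union_le _ _)
        intro z hz
        by_contra hcon
        simp only [Set.mem_union, Set.mem_ofPred_eq, not_or, not_not] at hcon hz
        exact hz (by rw [hcon.1, hcon.2, sub_zero])
      calc 2 ^ (n + 1) = 2 * 2 ^ n := by ring
        _ ≤ 2 * (2 ^ d * {z : Cube n | Q (Fin.cons true z) - Q (Fin.cons false z) ≠ 0}.ncard) := by
          gcongr
        _ ≤ 2 * (2 ^ d * {x | Q x ≠ 0}.ncard) := by gcongr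
        _ = _ := by ring

end JuntaSum

/-! ### Integer interpolation formulas valid over every Abelian group -/

section Interpolation

variable {κ : Type} [DecidableEq κ] [Fintype κ] {d : ℕ}

/-- The vector of the values at `y` of all indicator functions of `d` coordinates. -/
def evalVec (d : ℕ) (y : κ → Bool) : (Fin d → κ) × (Fin d → Bool) → ℤ :=
  fun p => if y ∘ p.1 = p.2 then 1 else 0

/-- A junta is a function of `y ∘ s` for some `s : Fin d → κ`. Grouping the points by `b = y ∘ s`
leaves, for each group, the entry `(s, b)` of the vector relation. Nonemptiness of `κ` serves to pad
a smaller `J` to `d` coordinates. -/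
lemma sum_smul_eq_zero_of_evalVec [Nonempty κ] {G : Type*} [AddCommGroup G]
    {Q : (κ → Bool) → G} (hQ : Q ∈ juntaSum d κ G) (c : (κ → Bool) → ℤ)
    (hc : ∑ y, c y • evalVec d y = 0) : ∑ y, c y • Q y = 0 := by
  induction hQ using AddSubgroup.closure_induction with
  | mem g hg =>
    obtain ⟨J, hJ, hg⟩ := hg
    obtain ⟨s, hs⟩ : ∃ s : Fin d → κ, ∀ i ∈ J, ∃ k, s k = i := by
      have e := J.equivFin.symm
      refine ⟨fun k => if h : k.1 < J.card then (e ⟨k, h⟩ : κ) else Classical.arbitrary κ, ?_⟩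
      intro i hi
      refine ⟨⟨(e.symm ⟨i, hi⟩).1, (e.symm ⟨i, hi⟩).2.trans_le hJ⟩, ?_⟩
      simp
    classical
    rw [← Finset.sum_fiberwise_of_maps_to (t := univ) (g := fun y : κ → Bool => y ∘ s)
      (fun _ _ => mem_univ _)]
    refine Finset.sum_eq_zero fun b _ => ?_
    by_cases hb : ∃ y : κ → Bool, y ∘ s = b
    · obtain ⟨y₀, hy₀⟩ := hb
      have h1 : ∀ y ∈ univ.filter (fun y : κ → Bool => y ∘ s = b), c y • g y = c y • g y₀ := by
        intro y hy
        rw [mem_filter] at hy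
        congr 1
        refine hg fun i hi => ?_
        obtain ⟨k, rfl⟩ := hs i hi
        exact congrFun (hy.2.trans hy₀.symm) k
      rw [Finset.sum_congr rfl h1, ← Finset.sum_smul]
      have h2 := congrFun hc (s, b)
      simp only [Finset.sum_apply, Pi.smul_apply, evalVec, smul_eq_mul, mul_ite, mul_one, mul_zero,
        Pi.zero_apply] at h2
      rw [← Finset.sum_filter] at h2
      rw [h2, zero_smul]
    · refine Finset.sum_eq_zero fun y hy => ?_
      exact absurd ⟨y, (mem_filter.1 hy).2⟩ hb
  | zero => simp
  | add x y _ _ hx hy => simp [smul_add, Finset.sum_add_distrib, hx, hy]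
  | neg x _ hx => simp [hx]

/-- The hypothesis is applied to a universal example: the quotient of the lattice by the span, with
`Q` sending `y` to the class of `evalVec d y`. Each entry of that vector is a junta. -/
lemma evalVec_mem_span {S : Set (κ → Bool)} {a : κ → Bool}
    (h : ∀ (G : Type) [AddCommGroup G] (Q : (κ → Bool) → G), Q ∈ juntaSum d κ G →
      (∀ y ∈ S, Q y = 0) → Q a = 0) :
    evalVec d a ∈ Submodule.span ℤ (evalVec d '' S) := by
  set Λ := Submodule.span ℤ (evalVec d '' S) with hΛ
  have hz := h (_ ⧸ Λ) (fun y => Λ.mkQ (evalVec d y)) ?_ ?_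
  · simpa using hz
  · have : (fun y : κ → Bool => Λ.mkQ (evalVec d y)) =
        ∑ p : (Fin d → κ) × (Fin d → Bool), fun y : κ → Bool =>
          Λ.mkQ (evalVec d y p • Pi.single p (1 : ℤ)) := by
      ext y
      rw [Finset.sum_apply, ← map_sum]
      congr 1
      ext p
      simp [Finset.sum_apply, Pi.single_apply]
    rw [this]
    refine AddSubgroup.sum_mem _ fun p _ => mem_juntaSum_of_dependsOn (J := univ.image p.1)
      (card_image_le.trans (by simp)) ?_
    intro x y hxy
    have : x ∘ p.1 = y ∘ p.1 := by
      ext k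
      rw [Function.comp, Function.comp, hxy (p.1 k) (by simp)]
    simp only [evalVec, this]
  · intro y hy
    rw [Submodule.mkQ_apply, Submodule.Quotient.mk_eq_zero]
    exact Submodule.subset_span ⟨y, hy, rfl⟩

/-- The point is the order of quantifiers: the coefficients come from the lattice alone and serve
all groups and functions at once. -/
lemma exists_coeff_of_mem_span [Nonempty κ] {S : Finset (κ → Bool)} {a : κ → Bool}
    (h : evalVec d a ∈ Submodule.span ℤ (evalVec d '' (S : Set (κ → Bool)))) :
    ∃ c : (κ → Bool) → ℤ, ∀ (G : Type*) [AddCommGroup G] (Q : (κ → Bool) → G),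
      Q ∈ juntaSum d κ G → ∑ y ∈ S, c y • Q y = Q a := by
  obtain ⟨c, hc⟩ := Submodule.mem_span_image_finset_iff_exists_fun' ℤ |>.1 h
  refine ⟨c, fun G _ Q hQ => ?_⟩
  have := sum_smul_eq_zero_of_evalVec hQ (fun y => (if y ∈ S then c y else 0) - if y = a then 1 else 0)
    (by
      simp only [sub_smul, Finset.sum_sub_distrib, ite_smul, zero_smul, one_smul,
        Finset.sum_ite_mem, Finset.univ_inter, Finset.sum_ite_eq', Finset.mem_univ, if_true, hc,
        sub_self])
  simpa [sub_smul, Finset.sum_sub_distrib, ite_smul, sub_eq_zero] using this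

/-- Every element of a span of `0/1` vectors of length `D` is an integer combination of `m` of
them, where `2^m ≤ (m+1)^D`. -/
lemma exists_small_spanning_subset {α ι : Type*} [DecidableEq α] [Fintype ι] (v : α → ι → ℤ)
    (hv : ∀ x p, v x p = 0 ∨ v x p = 1) (S : Finset α) :
    ∃ S₀ ⊆ S, 2 ^ S₀.card ≤ (S₀.card + 1) ^ Fintype.card ι ∧
      Submodule.span ℤ (v '' (S : Set α)) = Submodule.span ℤ (v '' (S₀ : Set α)) := by
  classical
  -- Keep a vector only if it is outside the span of those kept before. Then two subsets with equal
  -- sums must agree on the newest vector, so all subset sums are distinct; they lie in a box of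
  -- side `S₀.card + 1`.
  obtain ⟨S₀, h1, h2, h3⟩ : ∃ S₀ ⊆ S,
      Set.InjOn (fun T : Finset α => ∑ x ∈ T, v x) (S₀.powerset : Set (Finset α)) ∧
      Submodule.span ℤ (v '' (S : Set α)) = Submodule.span ℤ (v '' (S₀ : Set α)) := by
    induction S using Finset.induction_on with
    | empty => exact ⟨∅, subset_rfl, by simp, rfl⟩
    | insert a S _ ih =>
      obtain ⟨S₀, h1, h2, h3⟩ := ih
      by_cases ha : v a ∈ Submodule.span ℤ (v '' (S₀ : Set α))
      · refine ⟨S₀, h1.trans (subset_insert _ _), h2, ?_⟩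
        rw [coe_insert, Set.image_insert_eq, Submodule.span_insert_eq_span (h3 ▸ ha), h3]
      · refine ⟨insert a S₀, insert_subset_insert _ h1, ?_, ?_⟩
        · have haS : a ∉ S₀ := fun h => ha (Submodule.subset_span ⟨a, h, rfl⟩)
          have hmem : ∀ T ⊆ S₀, ∑ x ∈ T, v x ∈ Submodule.span ℤ (v '' (S₀ : Set α)) :=
            fun T hT => Submodule.sum_mem _ fun x hx => Submodule.subset_span ⟨x, hT hx, rfl⟩
          have key : ∀ T ⊆ S₀, ∀ T' ⊆ S₀, ∑ x ∈ insert a T, v x ≠ ∑ x ∈ T', v x := by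
            intro T hT T' hT' h
            rw [sum_insert (fun h => haS (hT h))] at h
            exact ha (by
              rw [eq_sub_of_add_eq h]
              exact Submodule.sub_mem _ (hmem _ hT') (hmem _ hT))
          have hcase : ∀ T ⊆ insert a S₀, T ⊆ S₀ ∨ ∃ T₀ ⊆ S₀, T = insert a T₀ := by
            intro T hT
            by_cases h : a ∈ T
            · exact Or.inr ⟨T.erase a, by
                rw [← Finset.subset_insert_iff]; exact hT, (insert_erase h).symm⟩
            · exact Or.inl ((subset_insert_iff_of_notMem h).1 hT)
          intro T hT T' hT' h
          simp only [coe_powerset, Set.mem_preimage, Set.mem_powerset_iff, coe_subset] at hT hT'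
          simp only at h
          rcases hcase T hT with h4 | ⟨T₀, h4, rfl⟩ <;> rcases hcase T' hT' with h5 | ⟨T₁, h5, rfl⟩
          · exact h2 (by simpa using h4) (by simpa using h5) h
          · exact absurd h.symm (key _ h5 _ h4)
          · exact absurd h (key _ h4 _ h5)
          · rw [sum_insert (fun h => haS (h4 h)), sum_insert (fun h => haS (h5 h))] at h
            rw [h2 (by simpa using h4) (by simpa using h5) (add_left_cancel h)]
        · rw [coe_insert, coe_insert, Set.image_insert_eq, Set.image_insert_eq,
            Submodule.span_insert, Submodule.span_insert, h3]
  refine ⟨S₀, h1, ?_, h3⟩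
  have hb : ∀ T ⊆ S₀, ∀ p, 0 ≤ (∑ x ∈ T, v x) p ∧ (∑ x ∈ T, v x) p ≤ S₀.card := by
    intro T hT p
    rw [Finset.sum_apply]
    refine ⟨sum_nonneg fun x _ => by rcases hv x p with h | h <;> simp [h], ?_⟩
    calc ∑ x ∈ T, v x p ≤ ∑ x ∈ T, 1 := sum_le_sum fun x _ => by
          rcases hv x p with h | h <;> simp [h]
      _ = T.card := by simp
      _ ≤ S₀.card := by exact_mod_cast card_le_card hT
  have := Finset.card_le_card_of_injOn (s := S₀.powerset)
    (t := Fintype.piFinset fun _ : ι => Finset.Icc (0 : ℤ) S₀.card)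
    (fun T => ∑ x ∈ T, v x) (fun T hT => by
      rw [mem_coe, Fintype.mem_piFinset]
      intro p
      rw [mem_Icc]
      exact hb T (by simpa using hT) p) h2
  simpa [card_powerset, Fintype.card_piFinset] using this

end Interpolation

/-! ### Vanishing on a window of weights forces vanishing at the origin -/

section Chain

variable {κ : Type*} [DecidableEq κ]

/-- The indicator vector of a set of coordinates. -/
def indVec (A : Finset κ) : κ → Bool := fun i => decide (i ∈ A)

/-- The total weight of a set of coordinates, where a coordinate of level `j` weighs `2^j`. -/
def levelWeight (lev : κ → ℕ) (A : Finset κ) : ℕ := ∑ i ∈ A, 2 ^ lev i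

/-- The number of coordinates of level `j`. -/
def levelCount (lev : κ → ℕ) (A : Finset κ) (j : ℕ) : ℕ := (A.filter fun i => lev i = j).card

variable {lev : κ → ℕ}

lemma levelWeight_union {A B : Finset κ} (h : Disjoint A B) :
    levelWeight lev (A ∪ B) = levelWeight lev A + levelWeight lev B := sum_union h

lemma levelCount_union_le (A B : Finset κ) (j : ℕ) :
    levelCount lev (A ∪ B) j ≤ levelCount lev A j + levelCount lev B j := by
  unfold levelCount
  rw [filter_union]
  exact card_union_le _ _

omit [DecidableEq κ] in
lemma two_pow_mul_levelCount_le (A : Finset κ) (j : ℕ) :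
    2 ^ j * levelCount lev A j ≤ levelWeight lev A := by
  calc 2 ^ j * levelCount lev A j = ∑ i ∈ A.filter (fun i => lev i = j), 2 ^ lev i := by
        rw [sum_congr rfl (g := fun _ => 2 ^ j) (fun i hi => by rw [(mem_filter.1 hi).2])]
        simp [levelCount, mul_comm]
    _ ≤ levelWeight lev A := sum_le_sum_of_subset (filter_subset _ _)

omit [DecidableEq κ] in
lemma levelCount_eq_zero {A : Finset κ} {j : ℕ} (h : ∀ x ∈ A, lev x ≠ j) :
    levelCount lev A j = 0 := by
  unfold levelCount
  rw [card_eq_zero, filter_eq_empty_iff]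
  exact fun x hx => h x hx

lemma levelCount_le_sdiff_add (F J : Finset κ) (j : ℕ) :
    levelCount lev F j ≤ levelCount lev (F \ J) j + levelCount lev J j := by
  refine le_trans ?_ (levelCount_union_le _ _ _)
  refine card_le_card (filter_subset_filter _ ?_)
  intro x hx
  by_cases h : x ∈ J <;> simp [h, hx]

omit [DecidableEq κ] in
lemma levelCount_singleton_le (e : κ) (j : ℕ) : levelCount lev {e} j ≤ 1 :=
  (card_filter_le _ _).trans (by simp)

lemma freeze_indVec {J W A : Finset κ} (hW : W ⊆ J) (hA : Disjoint A J) :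
    (fun i => if i ∈ J then indVec W i else indVec A i) = indVec (W ∪ A) := by
  ext i
  by_cases h : i ∈ J
  · have : i ∉ A := fun h' => Finset.disjoint_left.1 hA h' h
    simp [indVec, h, this]
  · have : i ∉ W := fun h' => h (hW h')
    simp [indVec, h, this]

/-- The greedy step: if adding a coordinate never changes `Q` as long as the weight stays at most
`t`, then the value at `∅` is the value at a set of weight exactly `t`. -/
lemma apply_indVec_empty_of_step {G : Type*} [AddCommGroup G] {r t : ℕ} {F : Finset κ}
    {Q : (κ → Bool) → G} (hF : ∀ j < r, 1 ≤ levelCount lev F j)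
    (ht : t ≤ 2 ^ r * levelCount lev F r)
    (hstep : ∀ i ≤ r, ∀ R ⊆ F, (∀ x ∈ R, i ≤ lev x) → (∀ j < r, levelCount lev R j ≤ 1) →
      ∀ e ∈ F, e ∉ R → lev e = i → levelWeight lev R + 2 ^ i ≤ t →
      Q (indVec (insert e R)) = Q (indVec R))
    (hQ : ∀ A ⊆ F, levelWeight lev A = t → Q (indVec A) = 0) :
    Q (indVec ∅) = 0 := by
  have hins : ∀ (R : Finset κ) (e : κ), e ∉ R →
      levelWeight lev (insert e R) = levelWeight lev R + 2 ^ lev e := by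
    intro R e he
    rw [levelWeight, sum_insert he, add_comm]
    rfl
  -- With less than `2^i` of weight missing, the gap is filled along its binary expansion, using at
  -- most one coordinate of each level below `i`.
  have low : ∀ i ≤ r, ∀ R ⊆ F, (∀ x ∈ R, i ≤ lev x) → (∀ j < r, levelCount lev R j ≤ 1) →
      levelWeight lev R ≤ t → t < levelWeight lev R + 2 ^ i → Q (indVec R) = 0 := by
    intro i
    induction i with
    | zero =>
      intro _ R hR _ _ h1 h2
      exact hQ R hR (by omega)
    | succ i ih =>
      intro hi R hR hRl hRc h1 h2
      by_cases h3 : t < levelWeight lev R + 2 ^ i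
      · exact ih (by omega) R hR (fun x hx => by have := hRl x hx; omega) hRc h1 h3
      · obtain ⟨e, he⟩ := Finset.card_pos.1 (hF i (by omega))
        rw [mem_filter] at he
        have heR : e ∉ R := fun h => by have := hRl e h; omega
        rw [← hstep i (by omega) R hR (fun x hx => by have := hRl x hx; omega) hRc e he.1 heR he.2
          (by omega)]
        refine ih (by omega) _ (insert_subset he.1 hR) ?_ ?_ ?_ ?_
        · intro x hx
          rcases mem_insert.1 hx with rfl | hx
          · omega
          · have := hRl x hx; omega
        · intro j hj
          rw [insert_eq]
          refine (levelCount_union_le _ _ _).trans ?_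
          by_cases hji : j = i
          · have : levelCount lev R j = 0 := levelCount_eq_zero fun x hx => by
              have := hRl x hx; omega
            have := levelCount_singleton_le (lev := lev) e j
            omega
          · have : levelCount lev {e} j = 0 := levelCount_eq_zero fun x hx => by
              rw [mem_singleton.1 hx]; omega
            have := hRc j hj
            omega
        · rw [hins _ _ heR, he.2]; omega
        · rw [hins _ _ heR, he.2, pow_succ] at *; omega
  -- Top-level coordinates are added until the gap is below `2^r`. They cannot run out, since by
  -- `ht` that level alone can carry weight `t`. The number `m` only bounds the remaining gap.
  have high : ∀ m : ℕ, ∀ R ⊆ F, (∀ x ∈ R, r ≤ lev x) → levelWeight lev R ≤ t →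
      t ≤ levelWeight lev R + m → Q (indVec R) = 0 := by
    intro m
    induction m with
    | zero =>
      intro R hR _ h1 h2
      exact hQ R hR (by omega)
    | succ m ih =>
      intro R hR hRl h1 h2
      have hRc : ∀ j < r, levelCount lev R j ≤ 1 := fun j hj => by
        rw [levelCount_eq_zero fun x hx => by have := hRl x hx; omega]
        exact zero_le_one
      by_cases h3 : t < levelWeight lev R + 2 ^ r
      · exact low r le_rfl R hR hRl hRc h1 h3
      · have hlt : levelCount lev R r < levelCount lev F r := by
          by_contra hcon
          have h5 := two_pow_mul_levelCount_le (lev := lev) R r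
          have h6 : 2 ^ r * levelCount lev F r ≤ 2 ^ r * levelCount lev R r :=
            Nat.mul_le_mul_left _ (by omega)
          have := Nat.two_pow_pos r
          omega
        obtain ⟨e, he⟩ : ∃ e, e ∈ (F.filter fun i => lev i = r) ∧
            e ∉ (R.filter fun i => lev i = r) := by
          by_contra hcon
          push Not at hcon
          exact absurd (card_le_card hcon) (not_le.2 hlt)
        simp only [mem_filter, not_and] at he
        have heR : e ∉ R := fun h => he.2 h he.1.2
        have h2r := Nat.two_pow_pos r
        rw [← hstep r le_rfl R hR hRl hRc e he.1.1 heR he.1.2 (by omega)]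
        refine ih _ (insert_subset he.1.1 hR) ?_ ?_ ?_
        · intro x hx
          rcases mem_insert.1 hx with rfl | hx
          · omega
          · exact hRl x hx
        · rw [hins _ _ heR, he.1.2]; omega
        · rw [hins _ _ heR, he.1.2]; omega
  exact high t ∅ (empty_subset _) (by simp) (by simp [levelWeight]) (by simp [levelWeight])

/-- A function of degree `d` that vanishes on all sets of coordinates whose weight lies in a window
of length `d` vanishes at the empty set. -/
theorem apply_indVec_empty_of_window {G : Type*} [AddCommGroup G] {r : ℕ} (hr : 0 < r) :
    ∀ {d t : ℕ} {F : Finset κ} {Q : (κ → Bool) → G}, Q ∈ juntaSum d κ G →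
      (∀ j < r, 2 * d + 1 ≤ levelCount lev F j) →
      t ≤ 2 ^ r * levelCount lev F r →
      (∀ A ⊆ F, t ≤ levelWeight lev A → levelWeight lev A ≤ t + d → Q (indVec A) = 0) →
      Q (indVec ∅) = 0 := by
  intro d
  induction d with
  | zero =>
    intro t F Q hQ hF ht hz
    exact apply_indVec_empty_of_step (lev := lev) (fun j hj => by simpa using hF j hj) ht
      (fun _ _ _ _ _ _ _ _ _ _ _ => juntaSum_zero_const hQ _ _)
      (fun A hA h => hz A hA h.ge h.le)
  | succ d ih =>
    intro t F Q hQ hF ht hz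
    -- `U` is as heavy as `V` or heavier by one. Freezing `J` in the two ways and subtracting gives
    -- degree `d`, and the difference vanishes on a window of length `d`: the possible excess of one
    -- is what shortens the window. At most two coordinates per lower level are used up, matching `2
    -- * d + 1`.
    have move : ∀ R ⊆ F, ∀ U ⊆ F, ∀ V ⊆ F, Disjoint R U → Disjoint R V →
        levelWeight lev V ≤ levelWeight lev U → levelWeight lev U ≤ levelWeight lev V + 1 →
        levelWeight lev R + levelWeight lev V ≤ t → (∀ x ∈ U, lev x < r) →
        (∀ j < r, levelCount lev (R ∪ U ∪ V) j ≤ 2) →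
        Q (indVec (R ∪ U)) = Q (indVec (R ∪ V)) := by
      intro R hR U hU V hV hRU hRV h1 h2 h3 hUr hc
      set J := R ∪ U ∪ V with hJ
      have hRUJ : R ∪ U ⊆ J := subset_union_left
      have hRVJ : R ∪ V ⊆ J := union_subset (subset_union_left.trans hRUJ) subset_union_right
      have key := ih (t := t - (levelWeight lev R + levelWeight lev V)) (F := F \ J)
        (juntaSum_sub_freeze hQ J (indVec (R ∪ U)) (indVec (R ∪ V)))
        ?_ ?_ ?_
      · rw [freeze_indVec hRUJ (disjoint_empty_left _), freeze_indVec hRVJ (disjoint_empty_left _),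
          union_empty, union_empty] at key
        exact sub_eq_zero.1 key
      · intro j hj
        have := levelCount_le_sdiff_add (lev := lev) F J j
        have := hF j hj
        have := hc j hj
        omega
      -- `U` avoids the top level, so the top-level coordinates lost belong to `R ∪ V`, whose weight
      -- has been subtracted from `t`.
      · have h4 := levelCount_le_sdiff_add (lev := lev) F J r
        have h5 : levelCount lev J r ≤ levelCount lev (R ∪ V) r := by
          refine card_le_card ?_
          intro x hx
          simp only [hJ, mem_filter, mem_union] at hx ⊢
          obtain ⟨(h | h) | h, hx⟩ := hx
          · exact ⟨Or.inl h, hx⟩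
          · exact absurd hx (hUr x h).ne
          · exact ⟨Or.inr h, hx⟩
        have h6 := two_pow_mul_levelCount_le (lev := lev) (R ∪ V) r
        rw [levelWeight_union hRV] at h6
        have h7 : 2 ^ r * levelCount lev F r ≤
            2 ^ r * levelCount lev (F \ J) r + 2 ^ r * levelCount lev (R ∪ V) r := by
          rw [← mul_add]
          exact Nat.mul_le_mul_left _ (by omega)
        omega
      · intro A hA h4 h5
        have hAJ : Disjoint A J := disjoint_of_subset_left hA sdiff_disjoint
        have hAF : A ⊆ F := hA.trans sdiff_subset
        rw [freeze_indVec hRUJ hAJ, freeze_indVec hRVJ hAJ,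
          hz _ (union_subset (union_subset hR hU) hAF), hz _ (union_subset (union_subset hR hV) hAF),
          sub_zero]
        all_goals
          rw [levelWeight_union (disjoint_of_subset_left (by assumption) hAJ.symm),
            levelWeight_union (by assumption)]
          omega
    refine apply_indVec_empty_of_step (lev := lev) (fun j hj => by have := hF j hj; omega) ht ?_
      (fun A hA h => hz A hA h.ge (by omega))
    -- Induction on the level of the added coordinate. At level zero it is compared with the empty
    -- set, a change of weight by one; `hr` ensures that it is not on the top level.
    intro i
    induction i with
    | zero =>
      intro _ R hR _ hRc e he heR hei hw
      have := move R hR {e} (by simpa using he) ∅ (empty_subset _)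
        (by simpa using heR) (disjoint_empty_right _) (by simp [levelWeight])
        (by simp [levelWeight, hei]) (by simp [levelWeight] at hw ⊢; omega)
        (by simpa [hei] using hr) ?_
      · rwa [union_empty, union_comm, ← insert_eq] at this
      · intro j hj
        have h1 := levelCount_union_le (lev := lev) (R ∪ {e}) ∅ j
        have h2 := levelCount_union_le (lev := lev) R {e} j
        have h3 := levelCount_singleton_le (lev := lev) e j
        have h4 := hRc j hj
        have h5 : levelCount lev ∅ j = 0 := by simp [levelCount]
        omega
    | succ i ihi =>
      intro hi R hR hRl hRc e he heR hei hw
      obtain ⟨e₁, he₁, e₂, he₂, hne⟩ := Finset.one_lt_card.1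
        (show 1 < levelCount lev F i by have := hF i (by omega); omega)
      rw [mem_filter] at he₁ he₂
      have h1R : e₁ ∉ R := fun h => by have := hRl _ h; omega
      have h2R : e₂ ∉ R := fun h => by have := hRl _ h; omega
      have hR0 : levelCount lev R i = 0 := levelCount_eq_zero fun x hx => by
        have := hRl _ hx; omega
      have hUw : levelWeight lev {e₁, e₂} = 2 ^ (i + 1) := by
        rw [levelWeight, sum_pair hne, he₁.2, he₂.2]; ring
      have hVw : levelWeight lev {e} = 2 ^ (i + 1) := by simp [levelWeight, hei]
      -- Trade `e` for two coordinates of half its weight, which the induction hypothesis then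
      -- removes one at a time.
      have hmv := move R hR {e₁, e₂} (by simp [insert_subset_iff, he₁.1, he₂.1]) {e}
        (by simpa using he) (by simp [h1R, h2R]) (by simpa using heR)
        (by rw [hUw, hVw]) (by rw [hUw, hVw]; omega) (by rw [hVw]; omega) (by
          intro x hx
          simp only [mem_insert, mem_singleton] at hx
          rcases hx with rfl | rfl <;> omega) ?_
      · have hpow : 2 ^ (i + 1) = 2 ^ i + 2 ^ i := by ring
        have hw2 : levelWeight lev (insert e₂ R) = levelWeight lev R + 2 ^ i := by
          rw [levelWeight, sum_insert h2R, he₂.2, add_comm]; rfl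
        have s1 := ihi (by omega) (insert e₂ R) (insert_subset he₂.1 hR) ?_ ?_ e₁ he₁.1
          (by simp [hne, h1R]) he₁.2 (by omega)
        · have s2 := ihi (by omega) R hR (fun x hx => by have := hRl _ hx; omega) hRc e₂ he₂.1 h2R
            he₂.2 (by omega)
          have e1 : insert e R = R ∪ {e} := by rw [insert_eq, union_comm]
          have e2 : R ∪ {e₁, e₂} = insert e₁ (insert e₂ R) := by
            ext x; simp only [mem_union, mem_insert, mem_singleton]; tauto
          rw [e1, ← hmv, e2, s1, s2]
        · intro x hx
          rcases mem_insert.1 hx with rfl | hx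
          · omega
          · have := hRl _ hx; omega
        · intro j hj
          rw [insert_eq]
          refine (levelCount_union_le _ _ _).trans ?_
          by_cases hji : j = i
          · have := levelCount_singleton_le (lev := lev) e₂ j
            subst hji
            omega
          · have : levelCount lev {e₂} j = 0 := levelCount_eq_zero fun x hx => by
              rw [mem_singleton.1 hx]; omega
            have := hRc j hj
            omega
      · intro j hj
        have h1 := levelCount_union_le (lev := lev) (R ∪ {e₁, e₂}) {e} j
        have h2 := levelCount_union_le (lev := lev) R {e₁, e₂} j
        have h3 := levelCount_singleton_le (lev := lev) e j
        have h4 := hRc j hj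
        by_cases hji : j = i
        · have h5 : levelCount lev {e} j = 0 := levelCount_eq_zero fun x hx => by
            rw [mem_singleton.1 hx]; omega
          have h6 : levelCount lev {e₁, e₂} j ≤ 2 := (card_filter_le _ _).trans card_le_two
          subst hji
          omega
        · have h5 : levelCount lev {e₁, e₂} j = 0 := levelCount_eq_zero fun x hx => by
            simp only [mem_insert, mem_singleton] at hx
            rcases hx with rfl | rfl <;> omega
          omega

end Chain

/-! ### Interpolating the origin from nearly balanced points -/

section BalancedInterpolation

/-- Coordinates of levels `0, …, r`, with `2 d + 2` coordinates on each level. -/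
abbrev Coord (d r : ℕ) : Type := Fin (r + 1) × Fin (2 * d + 2)

/-- A uniformly random element of `WeightedCoord d r` yields a coordinate with probability
proportional to its weight. -/
abbrev WeightedCoord (d r : ℕ) : Type := Σ i : Coord d r, Fin (2 ^ i.1.1)

/-- The sum of the weights of one half of the coordinates of each level. -/
def halfWeight (d r : ℕ) : ℕ := (d + 1) * (2 ^ (r + 1) - 1)

lemma card_weightedCoord (d r : ℕ) : Fintype.card (WeightedCoord d r) = 2 * halfWeight d r := by
  rw [Fintype.card_sigma]
  simp only [Fintype.card_fin, Fintype.sum_prod_type, sum_const, card_univ, smul_eq_mul]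
  rw [← mul_sum, Fin.sum_univ_eq_sum_range (fun i => 2 ^ i) (r + 1), Nat.geomSum_eq le_rfl,
    halfWeight]
  simp
  ring

/-- The number of weighted coordinates at which `y` is `true`. -/
def trueWeight {d r : ℕ} (y : Coord d r → Bool) : ℕ :=
  (univ.filter fun ω : WeightedCoord d r => y ω.1 = true).card

lemma trueWeight_indVec {d r : ℕ} (A : Finset (Coord d r)) :
    trueWeight (indVec A) = levelWeight (fun i : Coord d r => i.1.1) A := by
  have : (univ.filter fun ω : WeightedCoord d r => indVec A ω.1 = true) =
      A.sigma fun _ => univ := by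
    ext ω
    simp [indVec]
  rw [trueWeight, this, card_sigma]
  simp [levelWeight]

theorem apply_false_of_balanced {G : Type*} [AddCommGroup G] {d r : ℕ} (hr : 0 < r)
    {Q : (Coord d r → Bool) → G} (hQ : Q ∈ juntaSum d (Coord d r) G)
    (hz : ∀ y, halfWeight d r ≤ trueWeight y → trueWeight y ≤ halfWeight d r + d → Q y = 0) :
    Q (fun _ => false) = 0 := by
  have hcount : ∀ j ≤ r, levelCount (fun i : Coord d r => i.1.1) univ j = 2 * d + 2 := by
    intro j hj
    have : (univ.filter fun i : Coord d r => i.1.1 = j) =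
        ({⟨j, by omega⟩} : Finset (Fin (r + 1))) ×ˢ (univ : Finset (Fin (2 * d + 2))) := by
      ext ⟨a, b⟩
      simp [Fin.ext_iff, eq_comm]
    rw [levelCount, this, card_product]
    simp
  have : Q (indVec ∅) = 0 := by
    refine apply_indVec_empty_of_window (lev := fun i : Coord d r => i.1.1) hr
      (t := halfWeight d r) (F := univ) hQ ?_ ?_ ?_
    · intro j hj
      rw [hcount j hj.le]
      omega
    -- The `2 * d + 2` coordinates of the top level weigh `(d + 1) * 2 ^ (r + 1)`, more than half of
    -- the total.
    · rw [hcount r le_rfl, halfWeight]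
      calc (d + 1) * (2 ^ (r + 1) - 1) ≤ (d + 1) * 2 ^ (r + 1) :=
            Nat.mul_le_mul_left _ (Nat.sub_le _ _)
        _ = _ := by ring
    · intro A _ h1 h2
      exact hz _ (by rwa [trueWeight_indVec]) (by rwa [trueWeight_indVec])
  have h0 : (indVec ∅ : Coord d r → Bool) = fun _ => false := by ext; simp [indVec]
  rwa [h0] at this

/-- There are few nearly balanced points from whose values every function of degree `d` can be
computed at the origin. -/
theorem exists_balanced_interpolation (d : ℕ) {r : ℕ} (hr : 0 < r) :
    ∃ S : Finset (Coord d r → Bool),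
      2 ^ S.card ≤ (S.card + 1) ^ (4 * (d + 1) * (r + 1)) ^ d ∧
      (∀ y ∈ S, halfWeight d r ≤ trueWeight y ∧ trueWeight y ≤ halfWeight d r + d) ∧
      ∃ c : (Coord d r → Bool) → ℤ, ∀ (G : Type*) [AddCommGroup G] (Q : (Coord d r → Bool) → G),
        Q ∈ juntaSum d (Coord d r) G → ∑ y ∈ S, c y • Q y = Q fun _ => false := by
  classical
  set S₁ : Finset (Coord d r → Bool) := univ.filter fun y =>
    halfWeight d r ≤ trueWeight y ∧ trueWeight y ≤ halfWeight d r + d with hS₁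
  obtain ⟨S, h1, h2, h3⟩ := exists_small_spanning_subset (evalVec (κ := Coord d r) d)
    (fun x p => by unfold evalVec; split_ifs <;> simp) S₁
  refine ⟨S, ?_, fun y hy => (mem_filter.1 (h1 hy)).2, ?_⟩
  -- The number of entries of `evalVec` is `|κ|^d * 2^d` with `|κ| = (r + 1) * (2 * d + 2)`.
  · convert h2 using 2
    simp only [Fintype.card_prod, Fintype.card_fun, Fintype.card_fin, Fintype.card_bool, ← mul_pow]
    ring
  · refine exists_coeff_of_mem_span ?_
    rw [← h3]
    refine evalVec_mem_span fun G _ Q hQ hz => apply_false_of_balanced hr hQ fun y hy1 hy2 => ?_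
    exact hz y (by simp [hS₁, hy1, hy2])

/-- The embedding of a small cube into a big one that is given by a map `h` of the coordinates and
sends the origin to `x`. -/
def embedCube {n : ℕ} {κ : Type*} (x : Cube n) (h : Fin n → κ) (y : κ → Bool) : Cube n :=
  fun i => (x i ^^ y (h i))

lemma embedCube_false {n : ℕ} {κ : Type*} (x : Cube n) (h : Fin n → κ) :
    embedCube x h (fun _ => false) = x := by
  ext i
  simp [embedCube]

lemma juntaSum_embedCube {n d : ℕ} {κ G : Type*} [AddCommGroup G] {P : Cube n → G}
    (hP : P ∈ juntaSum d (Fin n) G) (x : Cube n) (h : Fin n → κ) :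
    (fun y => P (embedCube x h y)) ∈ juntaSum d κ G :=
  juntaSum_comp hP h fun i b => (x i ^^ b)

/-- The probability of an event on a finite set with the uniform distribution. -/
noncomputable def prob {Ω : Type*} [Fintype Ω] (p : Ω → Prop) : ℝ :=
  ({ω | p ω}.ncard : ℝ) / Fintype.card Ω

lemma relDist_eq_prob {n : ℕ} {G : Type*} (f g : Cube n → G) :
    relDist f g = prob fun x => f x ≠ g x := by
  simp [relDist, prob]

/-- Each coordinate of the image takes either value with probability at most `(t + d) / (2 * t)`,
independently. So every point is hit with probability at most `2^(-n) * (1 + d/t)^n`, and `t ≥ d *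
2^r ≥ d * n` bounds the second factor by `e < 3`. -/
lemma prob_embedCube_le {d r n : ℕ} (hn : n ≤ 2 ^ r) {y : Coord d r → Bool}
    (h1 : halfWeight d r ≤ trueWeight y) (h2 : trueWeight y ≤ halfWeight d r + d)
    (a : Cube n) (E : Cube n → Prop) :
    prob (fun h : Fin n → WeightedCoord d r => E (embedCube a (Sigma.fst ∘ h) y)) ≤
      3 * prob E := by
  classical
  set t := halfWeight d r with ht
  have hpow : 1 ≤ 2 ^ r := Nat.one_le_two_pow
  have htpos : d * 2 ^ r ≤ t ∧ 0 < t := by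
    rw [ht, halfWeight, pow_succ]
    constructor
    · exact Nat.mul_le_mul (by omega) (by omega)
    · exact Nat.mul_pos (by omega) (by omega)
  have hfib : ∀ b : Bool, (univ.filter fun ω : WeightedCoord d r => y ω.1 = b).card ≤ t + d := by
    intro b
    rcases b with _ | _
    · have := card_filter_add_card_filter_not (s := (univ : Finset (WeightedCoord d r)))
        (fun ω => y ω.1 = true)
      rw [card_univ, card_weightedCoord] at this
      simp only [Bool.not_eq_true] at this
      unfold trueWeight at h1
      omega
    · exact h2
  have hcard : {h : Fin n → WeightedCoord d r | E (embedCube a (Sigma.fst ∘ h) y)}.ncard ≤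
      {x | E x}.ncard * (t + d) ^ n := by
    rw [Set.ncard_eq_toFinset_card', Set.ncard_eq_toFinset_card']
    refine Finset.card_le_mul_card_image_of_maps_to (f := fun h => embedCube a (Sigma.fst ∘ h) y)
      (t := ({x | E x} : Set (Cube n)).toFinset) (fun h hh => by simpa using hh) _ ?_ |>.trans
      (by rw [mul_comm])
    intro x _
    calc _ ≤ (Fintype.piFinset fun i : Fin n =>
          univ.filter fun ω : WeightedCoord d r => y ω.1 = (a i ^^ x i)).card := by
          refine card_le_card fun h hh => ?_
          simp only [mem_filter] at hh
          simp only [Fintype.mem_piFinset, mem_filter, mem_univ, true_and]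
          intro i
          rw [← hh.2]
          simp [embedCube]
      _ ≤ _ := by
          rw [Fintype.card_piFinset]
          exact (prod_le_prod' fun i _ => hfib _).trans (by simp)
  have hexp : ((t + d : ℝ)) ^ n ≤ 3 * t ^ n := by
    have ht0 : (0 : ℝ) < t := by exact_mod_cast htpos.2
    have h3 : (d : ℝ) / t * n ≤ 1 := by
      rw [div_mul_eq_mul_div, div_le_one ht0]
      exact_mod_cast (Nat.mul_le_mul_left d hn).trans htpos.1
    calc ((t + d : ℝ)) ^ n = (d / t + 1) ^ n * t ^ n := by
          rw [← mul_pow]; congr 1; field_simp; ring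
      _ ≤ Real.exp (d / t) ^ n * t ^ n := by
          gcongr
          exact Real.add_one_le_exp _
      _ = Real.exp (d / t * n) * t ^ n := by
          rw [← Real.exp_nat_mul, mul_comm (n : ℝ)]
      _ ≤ 3 * t ^ n := by
          gcongr
          exact (Real.exp_le_exp.2 h3).trans (by have := Real.exp_one_lt_d9; linarith)
  have ht0 : (0 : ℝ) < t := by exact_mod_cast htpos.2
  have hE : (0 : ℝ) ≤ {x | E x}.ncard := Nat.cast_nonneg _
  unfold prob
  rw [Fintype.card_fun, card_weightedCoord, Fintype.card_fun, Fintype.card_fin, Fintype.card_bool,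
    ← mul_div_assoc, div_le_div_iff₀ (by push_cast; positivity) (by push_cast; positivity)]
  calc _ ≤ (({x | E x}.ncard * (t + d) ^ n : ℕ) : ℝ) * ((2 ^ n : ℕ) : ℝ) := by gcongr
    _ = {x | E x}.ncard * 2 ^ n * ((t : ℝ) + d) ^ n := by push_cast; ring
    _ ≤ {x | E x}.ncard * 2 ^ n * (3 * t ^ n) := by gcongr
    _ = _ := by push_cast; ring

end BalancedInterpolation

/-! ### Linear decision trees over an arbitrary Abelian group -/

/-- Query-free computations on stored group elements: branch on whether integer combinations are
zero, and output an integer combination. -/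
inductive LinTree (ι : Type) : Type
  | output (c : ι → ℤ) : LinTree ι
  | branch (c : ι → ℤ) (ifZero ifNonzero : LinTree ι) : LinTree ι

namespace LinTree

variable {ι κ : Type} [Fintype ι] {G : Type*} [AddCommGroup G]

open Classical in
/-- The output of the computation on the stored elements `r`. -/
noncomputable def eval (r : ι → G) : LinTree ι → G
  | output c => ∑ i, c i • r i
  | branch c t₀ t₁ => if ∑ i, c i • r i = 0 then eval r t₀ else eval r t₁

/-- A list of zero tests with a common failure branch. -/
lemma exists_eval_tests {β : Type*} (s : Finset β) (A : β → ι → ℤ) (t₀ t₁ : LinTree ι) :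
    ∃ t : LinTree ι, ∀ {G : Type*} [AddCommGroup G] (r : ι → G),
      ((∀ b ∈ s, ∑ i, A b i • r i = 0) → t.eval r = t₀.eval r) ∧
      ((¬ ∀ b ∈ s, ∑ i, A b i • r i = 0) → t.eval r = t₁.eval r) := by
  classical
  induction s using Finset.induction_on with
  | empty => exact ⟨t₀, fun r => by simp⟩
  | insert b s _ ih =>
    obtain ⟨t, ht⟩ := ih
    refine ⟨branch (A b) t t₁, fun {G} _ r => ?_⟩
    obtain ⟨h1, h2⟩ := ht r
    by_cases hb : ∑ i, A b i • r i = 0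
    · simp only [eval, hb, if_true, forall_mem_insert, true_and]
      exact ⟨h1, h2⟩
    · simp only [eval, hb, if_false, forall_mem_insert, false_and]
      simp

/-- The search for an item that passes all its zero tests. -/
lemma exists_eval_search {α β : Type*} (s : Finset α) (u : Finset β) (A : α → β → ι → ℤ)
    (out : α → ι → ℤ) :
    ∃ t : LinTree ι, ∀ {G : Type*} [AddCommGroup G] (r : ι → G),
      (∃ a ∈ s, ∀ b ∈ u, ∑ i, A a b i • r i = 0) →
      ∃ a ∈ s, (∀ b ∈ u, ∑ i, A a b i • r i = 0) ∧ t.eval r = ∑ i, out a i • r i := by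
  classical
  induction s using Finset.induction_on with
  | empty => exact ⟨output 0, fun r => by simp⟩
  | insert a s _ ih =>
    obtain ⟨t, ht⟩ := ih
    obtain ⟨t', ht'⟩ := exists_eval_tests u (A a) (output (out a)) t
    refine ⟨t', fun {G} _ r hr => ?_⟩
    obtain ⟨h1, h2⟩ := ht' r
    by_cases ha : ∀ b ∈ u, ∑ i, A a b i • r i = 0
    · exact ⟨a, mem_insert_self _ _, ha, h1 ha⟩
    · obtain ⟨a', ha', h3⟩ := hr
      rcases mem_insert.1 ha' with rfl | ha'
      · exact absurd h3 ha
      · obtain ⟨a'', h4, h5, h6⟩ := ht r ⟨a', ha', h3⟩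
        exact ⟨a'', mem_insert_of_mem h4, h5, (h2 ha).trans h6⟩

/-- Sequencing: a continuation that may use the value of a computation, as an integer
combination. -/
lemma exists_eval_bind (Φ : (ι → ℤ) → LinTree ι) (t : LinTree ι) :
    ∃ t' : LinTree ι, ∀ r : ι → G, ∃ c : ι → ℤ,
      t.eval r = ∑ i, c i • r i ∧ t'.eval r = (Φ c).eval r := by
  induction t with
  | output c => exact ⟨Φ c, fun r => ⟨c, rfl, rfl⟩⟩
  | branch c t₀ t₁ h₀ h₁ =>
    obtain ⟨u₀, h₀⟩ := h₀
    obtain ⟨u₁, h₁⟩ := h₁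
    refine ⟨branch c u₀ u₁, fun r => ?_⟩
    by_cases hc : ∑ i, c i • r i = 0
    · simpa [eval, hc] using h₀ r
    · simpa [eval, hc] using h₁ r

lemma exists_eval_bind_family [DecidableEq κ] (s : Finset κ) (u : κ → LinTree ι)
    (Φ : (κ → ι → ℤ) → LinTree ι) :
    ∃ t' : LinTree ι, ∀ r : ι → G, ∃ c : κ → ι → ℤ,
      (∀ k ∈ s, (u k).eval r = ∑ i, c k i • r i) ∧ t'.eval r = (Φ c).eval r := by
  induction s using Finset.induction_on generalizing Φ with
  | empty => exact ⟨Φ 0, fun r => ⟨0, by simp, rfl⟩⟩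
  | insert k s hk ih =>
    choose T hT using fun c : ι → ℤ => ih fun C => Φ (Function.update C k c)
    obtain ⟨t', ht'⟩ := exists_eval_bind (G := G) T (u k)
    refine ⟨t', fun r => ?_⟩
    obtain ⟨c, h1, h2⟩ := ht' r
    obtain ⟨C, h3, h4⟩ := hT c r
    refine ⟨Function.update C k c, ?_, h2.trans h4⟩
    intro j hj
    rcases mem_insert.1 hj with rfl | hj
    · simpa using h1
    · have : j ≠ k := fun h => hk (h ▸ hj)
      simpa [Function.update_of_ne this] using h3 j hj

lemma exists_eval_subst [Fintype κ] (t : LinTree κ) (c : κ → ι → ℤ) :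
    ∃ t' : LinTree ι, ∀ r : ι → G, t'.eval r = t.eval fun k => ∑ i, c k i • r i := by
  have key : ∀ (b : κ → ℤ) (r : ι → G), ∑ i, (∑ k, b k * c k i) • r i =
      ∑ k, b k • ∑ i, c k i • r i := by
    intro b r
    simp only [sum_smul, smul_sum, mul_smul]
    exact sum_comm
  induction t with
  | output b => exact ⟨output fun i => ∑ k, b k * c k i, fun r => key b r⟩
  | branch b t₀ t₁ h₀ h₁ =>
    obtain ⟨u₀, h₀⟩ := h₀
    obtain ⟨u₁, h₁⟩ := h₁
    exact ⟨branch (fun i => ∑ k, b k * c k i) u₀ u₁, fun r => by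
      simp only [eval, h₀, h₁]
      have hiff : ∑ i, (∑ k, b k * c k i) • r i = 0 ↔ ∑ k, b k • ∑ i, c k i • r i = 0 := by
        rw [key]
      by_cases h : ∑ k, b k • ∑ i, c k i • r i = 0
      · rw [if_pos h, if_pos (hiff.2 h)]
      · rw [if_neg h, if_neg (fun h' => h (hiff.1 h'))]⟩

/-- Computations may use the values of other computations. -/
theorem exists_eval_comp [Fintype κ] (t : LinTree κ) (u : κ → LinTree ι) :
    ∃ t' : LinTree ι, ∀ r : ι → G, t'.eval r = t.eval fun k => (u k).eval r := by
  classical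
  choose T hT using fun c : κ → ι → ℤ => exists_eval_subst (G := G) t c
  obtain ⟨t', ht'⟩ := exists_eval_bind_family (G := G) univ u T
  refine ⟨t', fun r => ?_⟩
  obtain ⟨c, h1, h2⟩ := ht' r
  rw [h2, hT]
  congr 1
  ext k
  exact (h1 k (mem_univ _)).symm

end LinTree

/-! ### Computations depending on few values, and their oracle programs -/

/-- A quantity depending on a function on the cube that is computed by a query-free computation
from the values at the points of a set of size at most `q`. -/
def LocallyComputable {n : ℕ} {G : Type*} [AddCommGroup G] (q : ℕ) (Φ : (Cube n → G) → G) : Prop :=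
  (∃ t : LinTree (Cube n), ∀ f, Φ f = t.eval f) ∧
    ∃ X : Finset (Cube n), X.card ≤ q ∧ DependsOn Φ (X : Set (Cube n))

section LocallyComputable

variable {n : ℕ} {G : Type*} [AddCommGroup G]

lemma locallyComputable_apply (x : Cube n) : LocallyComputable 1 fun f : Cube n → G => f x := by
  refine ⟨⟨.output (Pi.single x 1), fun f => ?_⟩, {x}, by simp, fun f g h => by simpa using h⟩
  simp [LinTree.eval, Pi.single_apply, ite_smul]

lemma LocallyComputable.comp {κ : Type} [Fintype κ] {q : ℕ} (t : LinTree κ)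
    {Φ : κ → (Cube n → G) → G} (s : Finset κ) (hΦ : ∀ k, LocallyComputable q (Φ k))
    (ht : DependsOn (fun r : κ → G => t.eval r) (s : Set κ)) :
    LocallyComputable (s.card * q) fun f => t.eval fun k => Φ k f := by
  classical
  choose u hu using fun k => (hΦ k).1
  choose X hX hXd using fun k => (hΦ k).2
  obtain ⟨t', ht'⟩ := LinTree.exists_eval_comp (G := G) t u
  refine ⟨⟨t', fun f => ?_⟩, s.biUnion X, card_biUnion_le_card_mul _ _ _ fun k _ => hX k, ?_⟩
  · rw [ht']
    simp only [hu]
  · intro f g hfg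
    refine ht fun k hk => hXd k fun x hx => hfg x ?_
    exact mem_biUnion.2 ⟨k, hk, hx⟩

open Classical in
lemma LinTree.exists_program {m : ℕ} (t : LinTree (Cube n)) (X : Finset (Cube n))
    (pts : Fin m → Cube n) (hX : ∀ x ∈ X, ∃ i, pts i = x) :
    ∃ p : OracleProgram n m, p.queries = 0 ∧ ∀ f : Cube n → G,
      p.eval f (f ∘ pts) = t.eval fun x => if x ∈ X then f x else 0 := by
  choose idx hidx using hX
  have key : ∀ (c : Cube n → ℤ) (f : Cube n → G),
      ∑ i, (∑ x ∈ X.attach with idx x.1 x.2 = i, c x) • (f ∘ pts) i =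
        ∑ x, c x • (if x ∈ X then f x else 0) := by
    intro c f
    simp only [sum_smul, smul_ite, smul_zero, sum_ite_mem, univ_inter, Function.comp]
    rw [← sum_attach X, ← sum_fiberwise_of_maps_to (s := X.attach) (t := univ)
      (g := fun x => idx x.1 x.2) (fun _ _ => mem_univ _)]
    refine sum_congr rfl fun i _ => sum_congr rfl fun x hx => ?_
    rw [mem_filter] at hx
    rw [← hx.2, hidx]
  induction t with
  | output c =>
    refine ⟨.output fun i => ∑ x ∈ X.attach with idx x.1 x.2 = i, c x, ?_, fun f => ?_⟩
    · simp [OracleProgram.queries]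
    · rw [OracleProgram.eval, LinTree.eval]
      exact key c f
  | branch c t₀ t₁ h₀ h₁ =>
    obtain ⟨p₀, q₀, h₀⟩ := h₀
    obtain ⟨p₁, q₁, h₁⟩ := h₁
    refine ⟨.branch (fun i => ∑ x ∈ X.attach with idx x.1 x.2 = i, c x) p₀ p₁, ?_, fun f => ?_⟩
    · simp [OracleProgram.queries, q₀, q₁]
    · simp only [OracleProgram.eval, LinTree.eval, key, h₀, h₁]

/-- The tree may mention every point of the cube, but replacing the values off `X` by zero does not
change its output. Querying `X` and then running the tree on this truncated data is enough. -/
theorem LocallyComputable.exists_program {q : ℕ} {Φ : (Cube n → G) → G}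
    (hΦ : LocallyComputable q Φ) :
    ∃ p : OracleProgram n 0, p.queries ≤ q ∧ ∀ f : Cube n → G, p.run f = Φ f := by
  classical
  obtain ⟨⟨t, ht⟩, X, hX, hXd⟩ := hΦ
  have hΦX : ∀ f, Φ f = t.eval fun x => if x ∈ X then f x else 0 := by
    intro f
    rw [← ht]
    refine hXd fun x hx => ?_
    rw [if_pos (by simpa using hx)]
  -- Here `j` bounds the number of points of `X` still to be queried.
  have main : ∀ (j m : ℕ) (pts : Fin m → Cube n), (X.filter fun x => ¬ ∃ i, pts i = x).card ≤ j →
      ∃ p : OracleProgram n m, p.queries ≤ j ∧ ∀ f : Cube n → G, p.eval f (f ∘ pts) = Φ f := by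
    intro j
    induction j with
    | zero =>
      intro m pts hj
      rw [Nat.le_zero, card_eq_zero, filter_eq_empty_iff] at hj
      obtain ⟨p, h1, h2⟩ := LinTree.exists_program (G := G) t X pts
        (fun x hx => not_not.1 (hj hx))
      exact ⟨p, h1.le, fun f => by rw [h2, hΦX]⟩
    | succ j ih =>
      intro m pts hj
      by_cases h0 : (X.filter fun x => ¬ ∃ i, pts i = x).card ≤ j
      · obtain ⟨p, h1, h2⟩ := ih m pts h0
        exact ⟨p, h1.trans (Nat.le_succ _), h2⟩
      · obtain ⟨x, hx⟩ := card_pos.1 (show 0 < (X.filter fun x => ¬ ∃ i, pts i = x).card by omega)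
        obtain ⟨p, h1, h2⟩ := ih (m + 1) (Fin.cons x pts) (by
          refine Nat.lt_succ_iff.1 (lt_of_lt_of_le (card_lt_card ?_) hj)
          rw [ssubset_iff_of_subset]
          · refine ⟨x, hx, ?_⟩
            simp only [mem_filter, not_and, not_not]
            exact fun _ => ⟨0, rfl⟩
          · refine monotone_filter_right _ fun y _ hy ⟨i, hi⟩ => hy ⟨i.succ, by simpa using hi⟩)
        refine ⟨.query x p, by simpa [OracleProgram.queries] using h1, fun f => ?_⟩
        rw [← h2 f, OracleProgram.eval]
        congr 1
        ext i
        refine Fin.cases rfl (fun i => rfl) i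
  obtain ⟨p, h1, h2⟩ := main q 0 Fin.elim0 ((card_filter_le _ _).trans hX)
  refine ⟨p, h1, fun f => ?_⟩
  rw [← h2 f, OracleProgram.run]
  congr 1
  ext i
  exact i.elim0

end LocallyComputable

-- Unique decoding on a small cube

universe u

/-- Unique decoding of functions of degree `d` on a small cube, at the origin, by a query-free
computation from all the values. -/
theorem exists_decoder (d : ℕ) {K : ℕ} (hK : 0 < K) :
    ∃ t : LinTree (Cube K), ∀ (G : Type u) [AddCommGroup G] (Q r : Cube K → G),
      Q ∈ juntaSum d (Fin K) G → 2 ^ (d + 1) * {y | r y ≠ Q y}.ncard < 2 ^ K →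
      t.eval r = Q fun _ => false := by
  classical
  have : Nonempty (Fin K) := ⟨⟨0, hK⟩⟩
  -- If fewer than `2^(K-d)` points are missing from `U`, a function of degree `d` vanishing on `U`
  -- is zero, so `U` interpolates the origin.
  have hcoeff : ∀ U : Finset (Cube K), ∃ c : Cube K → ℤ, 2 ^ d * Uᶜ.card < 2 ^ K →
      ∀ (G : Type u) [AddCommGroup G] (Q : Cube K → G), Q ∈ juntaSum d (Fin K) G →
        ∑ y ∈ U, c y • Q y = Q fun _ => false := by
    intro U
    by_cases hU : 2 ^ d * Uᶜ.card < 2 ^ K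
    · obtain ⟨c, hc⟩ := exists_coeff_of_mem_span.{u} (d := d) (S := U) (a := fun _ => false) (by
        refine evalVec_mem_span fun G _ Q hQ hz => ?_
        by_contra h0
        have h1 := two_pow_le_card_ne_zero hQ (fun h => h0 (congrFun h _))
        have h2 : {x | Q x ≠ 0}.ncard ≤ Uᶜ.card := by
          rw [← Set.ncard_coe_finset]
          refine Set.ncard_le_ncard (fun x hx => ?_) (Set.toFinite _)
          rw [mem_coe, mem_compl]
          exact fun hxU => hx (hz x (by simpa using hxU))
        exact absurd (h1.trans (Nat.mul_le_mul_left _ h2)) (not_le.2 hU))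
      exact ⟨c, fun _ => hc⟩
    · exact ⟨0, fun h => absurd h hU⟩
  choose c hc using hcoeff
  set out : Finset (Cube K) → Cube K → ℤ := fun U y => if y ∈ U then c U y else 0 with hout
  have hsum : ∀ (G : Type u) [AddCommGroup G] (U : Finset (Cube K)) (r : Cube K → G),
      ∑ y, out U y • r y = ∑ y ∈ U, c U y • r y := by
    intro G _ U r
    simp [hout, ite_smul]
  -- Candidates for the set of agreement. A candidate `T` passes if interpolation from `T` and from
  -- each `T ∩ T'` agree. The true set `T₀` passes, because intersections still miss fewer than
  -- `2^(K-d)` points. Any passing `T` gives the right value through its test against `T₀`, so `Q`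
  -- itself need not be found.
  set 𝒯 : Finset (Finset (Cube K)) := univ.filter fun T => 2 ^ (d + 1) * Tᶜ.card < 2 ^ K with h𝒯
  obtain ⟨t, ht⟩ := LinTree.exists_eval_search 𝒯 𝒯 (fun T T' => out T - out (T ∩ T')) out
  refine ⟨t, fun G _ Q r hQ hr => ?_⟩
  set T₀ : Finset (Cube K) := univ.filter fun y => r y = Q y with hT₀
  have hT₀m : T₀ ∈ 𝒯 := by
    rw [h𝒯, mem_filter]
    refine ⟨mem_univ _, ?_⟩
    convert hr using 2
    rw [← Set.ncard_coe_finset]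
    congr 1
    ext y
    simp [hT₀]
  have hval : ∀ T ∈ 𝒯, ∑ y, out (T ∩ T₀) y • r y = Q fun _ => false := by
    intro T hT
    rw [hsum, ← hc (T ∩ T₀) _ G Q hQ]
    · refine sum_congr rfl fun y hy => ?_
      rw [(mem_filter.1 (mem_inter.1 hy).2).2]
    · rw [h𝒯, mem_filter] at hT hT₀m
      have h1 : (T ∩ T₀)ᶜ.card ≤ Tᶜ.card + T₀ᶜ.card := by
        rw [compl_inter]
        exact card_union_le _ _
      have h2 := Nat.mul_le_mul_left (2 ^ d) h1
      have h3 := hT.2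
      have h4 := hT₀m.2
      rw [pow_succ] at h3 h4
      nlinarith
  have hdiff : ∀ T T' : Finset (Cube K), ∑ y, (out T - out (T ∩ T')) y • r y = 0 ↔
      ∑ y, out T y • r y = ∑ y, out (T ∩ T') y • r y := by
    intro T T'
    simp only [Pi.sub_apply, sub_smul, sum_sub_distrib, sub_eq_zero]
  obtain ⟨T, hT, h1, h2⟩ := ht r ⟨T₀, hT₀m, fun T' hT' => by
    rw [hdiff, inter_comm, hval T' hT', ← hval T₀ hT₀m, inter_self]⟩
  rw [h2, (hdiff T T₀).1 (h1 T₀ hT₀m), hval T hT]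

/-! ### Uniform probabilities on finite sets -/

section Probability

variable {Ω Ω' : Type*} [Fintype Ω] [Fintype Ω']

open Classical in
lemma prob_eq_expect (p : Ω → Prop) : prob p = 𝔼 ω, if p ω then (1 : ℝ) else 0 := by
  rw [Fintype.expect_eq_sum_div_card, prob, sum_boole, Set.ncard_eq_toFinset_card']
  congr 3
  ext
  simp

lemma prob_nonneg (p : Ω → Prop) : 0 ≤ prob p := by unfold prob; positivity

lemma relDist_nonneg {n : ℕ} {G : Type*} (f g : Cube n → G) : 0 ≤ relDist f g := by
  rw [relDist_eq_prob]
  exact prob_nonneg _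

lemma prob_le_one (p : Ω → Prop) : prob p ≤ 1 := by
  unfold prob
  refine div_le_one_of_le₀ ?_ (Nat.cast_nonneg _)
  rw [← Nat.card_eq_fintype_card]
  exact_mod_cast Set.ncard_le_card _

lemma prob_mono {p q : Ω → Prop} (h : ∀ ω, p ω → q ω) : prob p ≤ prob q := by
  unfold prob
  gcongr
  · exact Set.toFinite _
  · exact h _

lemma prob_or_le (p q : Ω → Prop) : prob (fun ω => p ω ∨ q ω) ≤ prob p + prob q := by
  unfold prob
  rw [← add_div]
  gcongr
  exact_mod_cast Set.ncard_union_le {ω | p ω} {ω | q ω}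

lemma prob_exists_le {ι : Type*} (s : Finset ι) (p : ι → Ω → Prop) :
    prob (fun ω => ∃ i ∈ s, p i ω) ≤ ∑ i ∈ s, prob (p i) := by
  classical
  induction s using Finset.induction_on with
  | empty => simp [prob]
  | insert i s hi ih =>
    rw [sum_insert hi]
    refine (prob_mono (q := fun ω => p i ω ∨ ∃ j ∈ s, p j ω) ?_).trans
      ((prob_or_le _ _).trans (by gcongr))
    rintro ω ⟨j, hj, h⟩
    rcases mem_insert.1 hj with rfl | hj
    · exact Or.inl h
    · exact Or.inr ⟨j, hj, h⟩

lemma prob_le_expect_div {X : Ω → ℝ} (hX : ∀ ω, 0 ≤ X ω) {a : ℝ} (ha : 0 < a) :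
    prob (fun ω => a ≤ X ω) ≤ (𝔼 ω, X ω) / a := by
  classical
  rw [prob_eq_expect, le_div_iff₀ ha, expect_mul]
  refine expect_le_expect fun ω _ => ?_
  split_ifs with h
  · simpa using h
  · simpa using hX ω

lemma prob_prod (p : Ω × Ω' → Prop) : prob p = 𝔼 ω, prob fun ω' => p (ω, ω') := by
  classical
  simp only [prob_eq_expect]
  rw [← univ_product_univ, expect_product]

lemma prob_equiv (e : Ω ≃ Ω') (p : Ω → Prop) (q : Ω' → Prop) (h : ∀ ω, p ω ↔ q (e ω)) :
    prob p = prob q := by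
  classical
  rw [prob_eq_expect, prob_eq_expect]
  exact Fintype.expect_equiv e _ _ fun ω => by simp [h]

lemma prob_not [Nonempty Ω] (p : Ω → Prop) : prob (fun ω => ¬ p ω) = 1 - prob p := by
  classical
  rw [prob_eq_expect, prob_eq_expect, eq_sub_iff_add_eq, ← expect_add_distrib,
    expect_congr rfl (g := fun _ => (1 : ℝ)) (fun ω _ => by by_cases h : p ω <;> simp [h])]
  exact Fintype.expect_const _

/-- A probability is at most that of a bad first component plus a bound for good ones. -/
lemma prob_prod_le {p : Ω × Ω' → Prop} (bad : Ω → Prop) {β γ : ℝ} (hβ : prob bad ≤ β)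
    (hγ0 : 0 ≤ γ) (hγ : ∀ ω, ¬ bad ω → prob (fun ω' => p (ω, ω')) ≤ γ) : prob p ≤ β + γ := by
  classical
  rcases isEmpty_or_nonempty Ω with hΩ | hΩ
  · have : prob p = 0 := by simp [prob]
    have := prob_nonneg bad
    linarith
  rw [prob_prod]
  calc 𝔼 ω, prob (fun ω' => p (ω, ω')) ≤ 𝔼 ω, ((if bad ω then (1 : ℝ) else 0) + γ) := by
        refine expect_le_expect fun ω _ => ?_
        split_ifs with h
        · have := prob_le_one fun ω' => p (ω, ω')
          linarith
        · simpa using hγ ω h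
    _ = prob bad + γ := by
        rw [expect_add_distrib, ← prob_eq_expect, Fintype.expect_const]
    _ ≤ β + γ := by gcongr

end Probability

/-! ### Correlation of a function with its noisy copy -/

section Noise

variable {κ : Type*} [Fintype κ] {n : ℕ}

/-- The correlation of `f x` and `g x'`, where `x` is uniformly random and `x'` is the image of the
point `b` of a small cube under a random embedding that sends the origin to `x`. -/
noncomputable def noiseCorr (b : κ → Bool) (f g : Cube n → ℝ) : ℝ :=
  𝔼 x, 𝔼 h : Fin n → κ, f x * g (embedCube x h b)

/-- The sign `-1` for `true` and `1` for `false`. -/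
def boolSign (b : Bool) : ℝ := if b then -1 else 1

/-- The correlation of a single coordinate with its noisy copy. -/
noncomputable def bias (b : κ → Bool) : ℝ := 𝔼 k, boolSign (b k)

lemma expect_cube_succ (F : Cube (n + 1) → ℝ) :
    𝔼 x, F x = ((𝔼 z : Cube n, F (Fin.cons false z)) + 𝔼 z : Cube n, F (Fin.cons true z)) / 2 := by
  rw [Fintype.expect_equiv (Fin.consEquiv fun _ => Bool).symm F
    (fun p => F (Fin.cons p.1 p.2)) (fun x => by simp [Fin.consEquiv]),
    ← univ_product_univ, expect_product, Fintype.expect_eq_sum_div_card]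
  simp [add_comm]

omit [Fintype κ] in
lemma embedCube_cons (x₀ : Bool) (x : Cube n) (k : κ) (h : Fin n → κ) (b : κ → Bool) :
    embedCube (Fin.cons x₀ x : Cube (n + 1)) (Fin.cons k h : Fin (n + 1) → κ) b =
      (Fin.cons (x₀ ^^ b k) (embedCube x h b) : Cube (n + 1)) := by
  ext i
  refine Fin.cases ?_ (fun i => ?_) i <;> simp [embedCube]

/-- The first coordinate is kept with probability `(1 + ρ) / 2` and flipped with probability `(1 -
ρ) / 2`, where `ρ = bias b`, independently of the rest. This recursion replaces Fourier analysis in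
both correlation bounds below. -/
lemma noiseCorr_succ [Nonempty κ] (b : κ → Bool) (f g : Cube (n + 1) → ℝ) :
    noiseCorr b f g =
      (1 + bias b) / 4 * (noiseCorr b (fun z => f (Fin.cons false z)) (fun z => g (Fin.cons false z))
        + noiseCorr b (fun z => f (Fin.cons true z)) (fun z => g (Fin.cons true z))) +
      (1 - bias b) / 4 * (noiseCorr b (fun z => f (Fin.cons false z)) (fun z => g (Fin.cons true z))
        + noiseCorr b (fun z => f (Fin.cons true z)) (fun z => g (Fin.cons false z))) := by
  have key : ∀ (x₀ : Bool), 𝔼 z : Cube n, 𝔼 h : Fin (n + 1) → κ,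
      f (Fin.cons x₀ z) * g (embedCube (Fin.cons x₀ z : Cube (n + 1)) h b) =
      (1 + bias b) / 2 * noiseCorr b (fun z => f (Fin.cons x₀ z)) (fun z => g (Fin.cons x₀ z)) +
      (1 - bias b) / 2 *
        noiseCorr b (fun z => f (Fin.cons x₀ z)) (fun z => g (Fin.cons (!x₀) z)) := by
    intro x₀
    have h1 : ∀ z : Cube n, 𝔼 h : Fin (n + 1) → κ,
        f (Fin.cons x₀ z) * g (embedCube (Fin.cons x₀ z : Cube (n + 1)) h b) =
        𝔼 k, 𝔼 h : Fin n → κ, f (Fin.cons x₀ z) * g (Fin.cons (x₀ ^^ b k) (embedCube z h b)) := by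
      intro z
      rw [Fintype.expect_equiv (Fin.consEquiv fun _ => κ).symm _
        (fun p => f (Fin.cons x₀ z) * g (Fin.cons (x₀ ^^ b p.1) (embedCube z p.2 b))) (fun h => ?_),
        ← univ_product_univ, expect_product]
      rw [← embedCube_cons]
      simp [Fin.consEquiv]
    simp only [h1]
    rw [expect_comm]
    have h2 : ∀ k, 𝔼 z : Cube n, 𝔼 h : Fin n → κ,
        f (Fin.cons x₀ z) * g (Fin.cons (x₀ ^^ b k) (embedCube z h b)) =
        (1 + boolSign (b k)) / 2 *
          noiseCorr b (fun z => f (Fin.cons x₀ z)) (fun z => g (Fin.cons x₀ z)) +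
        (1 - boolSign (b k)) / 2 *
          noiseCorr b (fun z => f (Fin.cons x₀ z)) (fun z => g (Fin.cons (!x₀) z)) := by
      intro k
      rcases hb : b k with _ | _ <;> simp [boolSign, noiseCorr]
    rw [expect_congr rfl fun k _ => h2 k, expect_add_distrib, ← expect_mul, ← expect_mul,
      ← expect_div, ← expect_div, expect_add_distrib, expect_sub_distrib, Fintype.expect_const, bias]
  rw [noiseCorr, expect_cube_succ, key, key]
  simp only [Bool.not_false, Bool.not_true]
  ring

lemma noiseCorr_zero [Nonempty κ] (b : κ → Bool) (f g : Cube 0 → ℝ) :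
    noiseCorr b f g = f default * g default := by
  unfold noiseCorr
  have : ∀ (x : Cube 0) (h : Fin 0 → κ), f x * g (embedCube x h b) = f default * g default :=
    fun x h => by rw [Subsingleton.elim x default, Subsingleton.elim (embedCube _ h b) default]
  simp only [this, Fintype.expect_const]

lemma expect_cube_zero (f : Cube 0 → ℝ) : 𝔼 x, f x = f default := by
  rw [expect_congr rfl (g := fun _ => f default) fun x _ => by rw [Subsingleton.elim x default]]
  exact Fintype.expect_const _

lemma noiseCorr_add_left (b : κ → Bool) (f f' g : Cube n → ℝ) :
    noiseCorr b (f + f') g = noiseCorr b f g + noiseCorr b f' g := by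
  simp [noiseCorr, add_mul, expect_add_distrib]

lemma noiseCorr_add_right (b : κ → Bool) (f g g' : Cube n → ℝ) :
    noiseCorr b f (g + g') = noiseCorr b f g + noiseCorr b f g' := by
  simp [noiseCorr, mul_add, expect_add_distrib]

lemma noiseCorr_smul (b : κ → Bool) (a : ℝ) (f g : Cube n → ℝ) :
    noiseCorr b (a • f) (a • g) = a ^ 2 * noiseCorr b f g := by
  simp only [noiseCorr, mul_expect, Pi.smul_apply, smul_eq_mul]
  refine expect_congr rfl fun x _ => expect_congr rfl fun h _ => by ring

lemma noiseCorr_sub_sub (b : κ → Bool) (f g : Cube n → ℝ) :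
    noiseCorr b (f - g) (f - g) =
      noiseCorr b f f - noiseCorr b f g - noiseCorr b g f + noiseCorr b g g := by
  simp only [noiseCorr, ← expect_add_distrib, ← expect_sub_distrib, Pi.sub_apply]
  refine expect_congr rfl fun x _ => expect_congr rfl fun h _ => by ring

/-- Apply `2 * |u * v| ≤ u ^ 2 + v ^ 2`; for fixed `h` the noisy copy is again uniform, since `x ↦
embedCube x h b` is an involution. -/
lemma abs_noiseCorr_self_le [Nonempty κ] (b : κ → Bool) (f : Cube n → ℝ) :
    |noiseCorr b f f| ≤ 𝔼 x, f x ^ 2 := by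
  have h1 : ∀ h : Fin n → κ, 𝔼 x, f (embedCube x h b) ^ 2 = 𝔼 x, f x ^ 2 := by
    intro h
    refine Fintype.expect_bijective (fun x => embedCube x h b) ?_ _ _ fun x => rfl
    refine Function.Involutive.bijective fun x => ?_
    ext i
    simp [embedCube]
  have h2 : 𝔼 x, 𝔼 h : Fin n → κ, (f x ^ 2 + f (embedCube x h b) ^ 2) / 2 = 𝔼 x, f x ^ 2 := by
    rw [expect_comm]
    have : ∀ h : Fin n → κ, 𝔼 x, (f x ^ 2 + f (embedCube x h b) ^ 2) / 2 = 𝔼 x, f x ^ 2 := by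
      intro h
      rw [← expect_div, expect_add_distrib, h1]
      ring
    simp only [this, Fintype.expect_const]
  rw [abs_le, ← h2, ← expect_neg_distrib, noiseCorr]
  constructor
  · refine expect_le_expect fun x _ => ?_
    rw [← expect_neg_distrib]
    refine expect_le_expect fun h _ => ?_
    nlinarith [sq_nonneg (f x + f (embedCube x h b))]
  · refine expect_le_expect fun x _ => expect_le_expect fun h _ => ?_
    nlinarith [sq_nonneg (f x - f (embedCube x h b))]

/-- Noisy copies are nearly independent when the bias is small. -/
theorem noiseCorr_self_le [Nonempty κ] (b : κ → Bool) : ∀ {n : ℕ} (f : Cube n → ℝ),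
    noiseCorr b f f ≤ (𝔼 x, f x) ^ 2 + |bias b| * (𝔼 x, f x ^ 2 - (𝔼 x, f x) ^ 2) := by
  intro n
  induction n with
  | zero =>
    intro f
    rw [noiseCorr_zero, expect_cube_zero, expect_cube_zero (fun x => f x ^ 2)]
    apply le_of_eq
    ring
  | succ n ih =>
    intro f
    set f₀ : Cube n → ℝ := fun z => f (Fin.cons false z) with hf₀
    set f₁ : Cube n → ℝ := fun z => f (Fin.cons true z) with hf₁
    set s : Cube n → ℝ := (1 / 2 : ℝ) • (f₀ + f₁) with hs
    set t : Cube n → ℝ := (1 / 2 : ℝ) • (f₀ - f₁) with ht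
    -- Even and odd parts in the first coordinate decouple. The odd part already carries a factor
    -- `bias b`, so the trivial bound suffices for it.
    have e1 : noiseCorr b f f = noiseCorr b s s + bias b * noiseCorr b t t := by
      rw [noiseCorr_succ, hs, ht, noiseCorr_smul, noiseCorr_smul, noiseCorr_sub_sub,
        noiseCorr_add_left, noiseCorr_add_right, noiseCorr_add_right]
      ring
    have e2 : 𝔼 x, f x = 𝔼 z, s z := by
      rw [expect_cube_succ, ← expect_add_distrib, expect_div]
      refine expect_congr rfl fun z _ => ?_
      simp [hs, hf₀, hf₁]
      ring
    have e3 : 𝔼 x, f x ^ 2 = 𝔼 z, s z ^ 2 + 𝔼 z, t z ^ 2 := by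
      rw [expect_cube_succ, ← expect_add_distrib, ← expect_add_distrib, expect_div]
      refine expect_congr rfl fun z _ => ?_
      simp [hs, ht, hf₀, hf₁]
      ring
    have h1 := ih s
    have h2 := abs_noiseCorr_self_le b t
    have h3 : bias b * noiseCorr b t t ≤ |bias b| * 𝔼 z, t z ^ 2 := by
      calc bias b * noiseCorr b t t ≤ |bias b * noiseCorr b t t| := le_abs_self _
        _ = |bias b| * |noiseCorr b t t| := abs_mul _ _
        _ ≤ _ := by gcongr
    rw [e1, e2, e3]
    linarith

end Noise

/-! ### Hypercontractivity and small-set expansion -/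

section SmallSets

/-- The two-point hypercontractive inequality with exponent `4/3`. -/
lemma two_point_inequality {u v : ℝ} (hu : 0 ≤ u) (hv : 0 ≤ v) :
    (((u ^ 3 + v ^ 3) / 2) ^ 2 + ((u ^ 3 - v ^ 3) / 2) ^ 2 / 3) ^ 2 ≤ ((u ^ 4 + v ^ 4) / 2) ^ 3 := by
  -- For the function with values `u ^ 3` and `v ^ 3` the `4/3` powers are polynomial, so the
  -- inequality becomes a factorization with a manifestly nonnegative cofactor.
  have h : ((u ^ 4 + v ^ 4) / 2) ^ 3 -
      (((u ^ 3 + v ^ 3) / 2) ^ 2 + ((u ^ 3 - v ^ 3) / 2) ^ 2 / 3) ^ 2 =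
      (u - v) ^ 4 / 72 * (u ^ 8 + 4 * u ^ 7 * v + 4 * u ^ 5 * v ^ 3 + 8 * u ^ 6 * v ^ 2 +
        8 * u ^ 2 * v ^ 6 + 2 * u ^ 4 * v ^ 4 + 2 * (u * v) ^ 2 * (u ^ 2 - v ^ 2) ^ 2 +
        4 * u ^ 3 * v ^ 5 + 4 * u * v ^ 7 + v ^ 8) := by
    ring
  have : 0 ≤ ((u ^ 4 + v ^ 4) / 2) ^ 3 -
      (((u ^ 3 + v ^ 3) / 2) ^ 2 + ((u ^ 3 - v ^ 3) / 2) ^ 2 / 3) ^ 2 := by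
    rw [h]
    positivity
  linarith

/-- The fourth root of a nonnegative number. -/
noncomputable def fourthRoot (a : ℝ) : ℝ := √√a

lemma fourthRoot_nonneg (a : ℝ) : 0 ≤ fourthRoot a := Real.sqrt_nonneg _

lemma fourthRoot_pow {a : ℝ} (ha : 0 ≤ a) : fourthRoot a ^ 4 = a := by
  have : fourthRoot a ^ 4 = (√√a ^ 2) ^ 2 := by unfold fourthRoot; ring
  rw [this, Real.sq_sqrt (Real.sqrt_nonneg a), Real.sq_sqrt ha]

lemma fourthRoot_mono {a b : ℝ} (h : a ≤ b) : fourthRoot a ≤ fourthRoot b :=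
  Real.sqrt_le_sqrt (Real.sqrt_le_sqrt h)

/-- With even and odd parts the left side is `s * s' + ρ * t * t'`. Cauchy–Schwarz and
`two_point_inequality` for each factor finish it. The cube of `fourthRoot` is the `3/4` power, so
the factors act as `L^(4/3)` norms of indicators; the bound `1/3` on `ρ` is `4/3 - 1`. -/
lemma two_point_bilinear {ρ : ℝ} (hρ : |ρ| ≤ 1 / 3) {α₀ α₁ β₀ β₁ : ℝ}
    (hα₀ : 0 ≤ α₀) (hα₁ : 0 ≤ α₁) (hβ₀ : 0 ≤ β₀) (hβ₁ : 0 ≤ β₁) :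
    (1 + ρ) / 4 * (fourthRoot α₀ ^ 3 * fourthRoot β₀ ^ 3 + fourthRoot α₁ ^ 3 * fourthRoot β₁ ^ 3) +
      (1 - ρ) / 4 * (fourthRoot α₀ ^ 3 * fourthRoot β₁ ^ 3 + fourthRoot α₁ ^ 3 * fourthRoot β₀ ^ 3) ≤
      fourthRoot ((α₀ + α₁) / 2) ^ 3 * fourthRoot ((β₀ + β₁) / 2) ^ 3 := by
  have key : ∀ {γ₀ γ₁ : ℝ}, 0 ≤ γ₀ → 0 ≤ γ₁ →
      ((fourthRoot γ₀ ^ 3 + fourthRoot γ₁ ^ 3) / 2) ^ 2 +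
        ((fourthRoot γ₀ ^ 3 - fourthRoot γ₁ ^ 3) / 2) ^ 2 / 3 ≤
      (fourthRoot ((γ₀ + γ₁) / 2) ^ 3) ^ 2 := by
    intro γ₀ γ₁ h₀ h₁
    refine le_of_sq_le_sq ?_ (by positivity)
    have := two_point_inequality (fourthRoot_nonneg γ₀) (fourthRoot_nonneg γ₁)
    rw [fourthRoot_pow h₀, fourthRoot_pow h₁] at this
    refine this.trans (le_of_eq ?_)
    have h2 := fourthRoot_pow (a := (γ₀ + γ₁) / 2) (by positivity)
    calc ((γ₀ + γ₁) / 2) ^ 3 = (fourthRoot ((γ₀ + γ₁) / 2) ^ 4) ^ 3 := by rw [h2]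
      _ = _ := by ring
  have kα := key hα₀ hα₁
  have kβ := key hβ₀ hβ₁
  set s := (fourthRoot α₀ ^ 3 + fourthRoot α₁ ^ 3) / 2 with hs
  set t := (fourthRoot α₀ ^ 3 - fourthRoot α₁ ^ 3) / 2 with ht
  set s' := (fourthRoot β₀ ^ 3 + fourthRoot β₁ ^ 3) / 2 with hs'
  set t' := (fourthRoot β₀ ^ 3 - fourthRoot β₁ ^ 3) / 2 with ht'
  set A := fourthRoot ((α₀ + α₁) / 2) ^ 3 with hA
  set B := fourthRoot ((β₀ + β₁) / 2) ^ 3 with hB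
  have hA0 : 0 ≤ A := pow_nonneg (fourthRoot_nonneg _) _
  have hB0 : 0 ≤ B := pow_nonneg (fourthRoot_nonneg _) _
  have e : (1 + ρ) / 4 * (fourthRoot α₀ ^ 3 * fourthRoot β₀ ^ 3 +
      fourthRoot α₁ ^ 3 * fourthRoot β₁ ^ 3) +
      (1 - ρ) / 4 * (fourthRoot α₀ ^ 3 * fourthRoot β₁ ^ 3 + fourthRoot α₁ ^ 3 * fourthRoot β₀ ^ 3)
      = s * s' + ρ * (t * t') := by
    rw [hs, ht, hs', ht']; ring
  rw [e]
  have h1 : ρ * (t * t') ≤ |t| * |t'| / 3 := by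
    calc ρ * (t * t') ≤ |ρ * (t * t')| := le_abs_self _
      _ = |ρ| * (|t| * |t'|) := by rw [abs_mul, abs_mul]
      _ ≤ 1 / 3 * (|t| * |t'|) := by gcongr
      _ = _ := by ring
  have h2 : s * s' + |t| * |t'| / 3 ≤ A * B := by
    refine abs_le_of_sq_le_sq' ?_ (by positivity) |>.2
    have hcs : (s * s' + |t| * |t'| / 3) ^ 2 ≤ (s ^ 2 + t ^ 2 / 3) * (s' ^ 2 + t' ^ 2 / 3) := by
      rw [← sq_abs t, ← sq_abs t']
      nlinarith [sq_nonneg (s * |t'| - s' * |t|)]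
    calc _ ≤ (s ^ 2 + t ^ 2 / 3) * (s' ^ 2 + t' ^ 2 / 3) := hcs
      _ ≤ A ^ 2 * B ^ 2 := by gcongr
      _ = _ := by ring
  linarith

variable {κ : Type*} [Fintype κ] [Nonempty κ]

/-- Small-set expansion: noisy copies rarely hit two small sets. -/
theorem noiseCorr_le_of_small_bias {b : κ → Bool} (hb : |bias b| ≤ 1 / 3) : ∀ {n : ℕ}
    {f g : Cube n → ℝ}, (∀ x, f x = 0 ∨ f x = 1) → (∀ x, g x = 0 ∨ g x = 1) →
    noiseCorr b f g ≤ fourthRoot (𝔼 x, f x) ^ 3 * fourthRoot (𝔼 x, g x) ^ 3 := by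
  intro n
  induction n with
  | zero =>
    intro f g hf hg
    rw [noiseCorr_zero, expect_cube_zero, expect_cube_zero g]
    rcases hf default with h | h <;> rcases hg default with h' | h' <;> rw [h, h'] <;>
      simp [fourthRoot]
  | succ n ih =>
    intro f g hf hg
    have hnn : ∀ {f : Cube (n + 1) → ℝ}, (∀ x, f x = 0 ∨ f x = 1) → ∀ i : Bool,
        0 ≤ 𝔼 z : Cube n, f (Fin.cons i z) := fun hf i =>
      expect_nonneg fun z _ => by rcases hf (Fin.cons i z) with h | h <;> simp [h]
    have hρ := abs_le.1 (hb.trans (by norm_num : (1 / 3 : ℝ) ≤ 1))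
    have hi : ∀ i j : Bool, noiseCorr b (fun z => f (Fin.cons i z)) (fun z => g (Fin.cons j z)) ≤ _ :=
      fun i j => ih (fun x => hf _) (fun x => hg _)
    rw [noiseCorr_succ, expect_cube_succ f, expect_cube_succ g]
    refine le_trans ?_ (two_point_bilinear hb (hnn hf false) (hnn hf true) (hnn hg false)
      (hnn hg true))
    have h1 : 0 ≤ (1 + bias b) / 4 := by linarith [hρ.1]
    have h2 : 0 ≤ (1 - bias b) / 4 := by linarith [hρ.2]
    gcongr
    exacts [hi _ _, hi _ _, hi _ _, hi _ _]

end SmallSets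

/-! ### Near-orthogonality of points of a small cube -/

section Bias

variable {K : ℕ}

lemma boolSign_xor (a b : Bool) : boolSign (a ^^ b) = boolSign a * boolSign b := by
  cases a <;> cases b <;> simp [boolSign]

lemma sum_boolSign_mul (i j : Fin K) :
    ∑ y : Cube K, boolSign (y i) * boolSign (y j) = if i = j then 2 ^ K else 0 := by
  split_ifs with h
  · subst h
    have : ∀ y : Cube K, boolSign (y i) * boolSign (y i) = 1 := fun y => by
      cases y i <;> simp [boolSign]
    simp [this]
  · have hinv : Function.Involutive fun y : Cube K => Function.update y i (!(y i)) := by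
      intro y
      simp
    have := Fintype.sum_bijective _ hinv.bijective
      (fun y : Cube K => -(boolSign (y i) * boolSign (y j)))
      (fun y : Cube K => boolSign (y i) * boolSign (y j)) (fun y => by
        rw [Function.update_self, Function.update_of_ne (Ne.symm h)]
        cases y i <;> cases y j <;> simp [boolSign])
    rw [sum_neg_distrib] at this
    linarith

/-- The pairwise biases of the points of the cube are small on average. -/
lemma expect_bias_sq (hK : 0 < K) :
    𝔼 y : Cube K, 𝔼 y' : Cube K, bias (fun k => (y k ^^ y' k)) ^ 2 = 1 / K := by
  have e : ∀ y y' : Cube K, bias (fun k => (y k ^^ y' k)) ^ 2 =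
      (∑ i, ∑ j, (boolSign (y i) * boolSign (y j)) * (boolSign (y' i) * boolSign (y' j))) /
        K ^ 2 := by
    intro y y'
    simp only [bias, Fintype.expect_eq_sum_div_card, boolSign_xor, Fintype.card_fin, div_pow]
    rw [sq, sum_mul_sum]
    congr 1
    refine sum_congr rfl fun i _ => sum_congr rfl fun j _ => by ring
  have e2 : ∑ y : Cube K, ∑ y' : Cube K, ∑ i, ∑ j,
      (boolSign (y i) * boolSign (y j)) * (boolSign (y' i) * boolSign (y' j)) =
      K * (2 ^ K * 2 ^ K) := by
    calc _ = ∑ i, ∑ j, ∑ y : Cube K, ∑ y' : Cube K,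
          (boolSign (y i) * boolSign (y j)) * (boolSign (y' i) * boolSign (y' j)) := by
          simp only [sum_comm (s := (univ : Finset (Cube K))) (t := (univ : Finset (Fin K)))]
      _ = ∑ i : Fin K, ∑ j : Fin K, (if i = j then 2 ^ K else 0) * (if i = j then 2 ^ K else 0) := by
          simp only [← sum_mul_sum, sum_boolSign_mul]
      _ = _ := by simp
  simp only [e, ← expect_div]
  simp only [Fintype.expect_eq_sum_div_card, ← sum_div, e2]
  simp
  field_simp

end Bias

/-! ### One round of decoding on random small cubes -/

/-- `t` decodes functions of degree `d` on the cube of dimension `K` at the origin, up to half the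
minimum distance. -/
def IsDecoder (d K : ℕ) (t : LinTree (Cube K)) : Prop :=
  ∀ (G : Type u) [AddCommGroup G] (Q r : Cube K → G), Q ∈ juntaSum d (Fin K) G →
    2 ^ (d + 1) * {y | r y ≠ Q y}.ncard < 2 ^ K → t.eval r = Q fun _ => false

section Step

variable {n K d : ℕ} {G : Type u} [AddCommGroup G]

/-- The function obtained by decoding at every point the restriction to the small cube through this
point that is given by `h`. -/
noncomputable def decodeStep (t : LinTree (Cube K)) (h : Fin n → Fin K) (f : Cube n → G) :
    Cube n → G :=
  fun x => t.eval fun y => f (embedCube x h y)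

lemma embedCube_embedCube (x : Cube n) (h : Fin n → Fin K) (y y' : Cube K) :
    embedCube (embedCube x h y) h (fun k => (y k ^^ y' k)) = embedCube x h y' := by
  ext i
  simp [embedCube]

lemma expect_embedCube (F : Cube n → ℝ) (h : Fin n → Fin K) (y : Cube K) :
    𝔼 x, F (embedCube x h y) = 𝔼 x, F x := by
  refine Fintype.expect_bijective (fun x => embedCube x h y) ?_ _ _ fun x => rfl
  refine Function.Involutive.bijective fun x => ?_
  ext i
  simp [embedCube]

/-- Averaging over `x`, the first point may be taken as the new base point; the second is then its
noisy copy with pattern `y ⊕ y'`. -/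
lemma expect_embedCube_mul (F : Cube n → ℝ) (y y' : Cube K) :
    𝔼 h : Fin n → Fin K, 𝔼 x, F (embedCube x h y) * F (embedCube x h y') =
      noiseCorr (fun k => (y k ^^ y' k)) F F := by
  rw [noiseCorr, expect_comm (s := (univ : Finset (Cube n)))]
  refine expect_congr rfl fun h _ => ?_
  rw [← expect_embedCube (fun x => F x * F (embedCube x h fun k => (y k ^^ y' k))) h y]
  simp only [embedCube_embedCube]

/-- The indicator function of the set of errors. -/
noncomputable def errorIndicator (f P : Cube n → G) : Cube n → ℝ :=
  Set.indicator {x | f x ≠ P x} 1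

omit [AddCommGroup G] in
lemma errorIndicator_eq_zero_or_one (f P : Cube n → G) (x : Cube n) :
    errorIndicator f P x = 0 ∨ errorIndicator f P x = 1 := by
  unfold errorIndicator
  by_cases h : x ∈ {x | f x ≠ P x} <;> simp [h]

omit [AddCommGroup G] in
lemma expect_errorIndicator (f P : Cube n → G) : 𝔼 x, errorIndicator f P x = relDist f P := by
  classical
  rw [relDist_eq_prob, prob_eq_expect]
  refine expect_congr rfl fun x _ => ?_
  simp [errorIndicator, Set.indicator_apply]

/-- The fraction of errors on a small cube. -/
noncomputable def errorFraction (f P : Cube n → G) (x : Cube n) (h : Fin n → Fin K) : ℝ :=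
  𝔼 y, errorIndicator f P (embedCube x h y)

lemma le_errorFraction_of_decodeStep_ne {t : LinTree (Cube K)} (ht : IsDecoder.{u} d K t)
    {P : Cube n → G} (hP : P ∈ juntaSum d (Fin n) G) {f : Cube n → G} {h : Fin n → Fin K}
    {x : Cube n} (hx : decodeStep t h f x ≠ P x) :
    1 / 2 ^ (d + 1) ≤ errorFraction f P x h := by
  by_contra hlt
  push Not at hlt
  refine hx ?_
  have := ht G (fun y => P (embedCube x h y)) (fun y => f (embedCube x h y))
    (juntaSum_embedCube hP x h) ?_
  · rw [decodeStep, this, embedCube_false]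
  · have e : errorFraction f P x h =
        prob fun y : Cube K => f (embedCube x h y) ≠ P (embedCube x h y) := by
      classical
      rw [prob_eq_expect]
      refine expect_congr rfl fun y _ => ?_
      simp [errorIndicator, Set.indicator_apply]
    rw [e, prob, lt_div_iff₀ (by positivity), div_mul_eq_mul_div, div_lt_iff₀ (by simp)] at hlt
    have hlt' : (({y : Cube K | f (embedCube x h y) ≠ P (embedCube x h y)}.ncard * 2 ^ (d + 1) : ℕ) : ℝ)
        < ((2 ^ K : ℕ) : ℝ) := by
      push_cast
      simpa using hlt
    rw [mul_comm]
    exact_mod_cast hlt'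

lemma relDist_decodeStep_le {t : LinTree (Cube K)} (ht : IsDecoder.{u} d K t)
    {P : Cube n → G} (hP : P ∈ juntaSum d (Fin n) G) (f : Cube n → G) (h : Fin n → Fin K) :
    relDist (decodeStep t h f) P ≤ prob fun x => 1 / 2 ^ (d + 1) ≤ errorFraction f P x h := by
  rw [relDist_eq_prob]
  exact prob_mono fun x hx => le_errorFraction_of_decodeStep_ne ht hP hx

omit [AddCommGroup G] in
lemma expect_errorFraction_sq (f P : Cube n → G) :
    𝔼 h : Fin n → Fin K, 𝔼 x, errorFraction f P x h ^ 2 =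
      𝔼 y : Cube K, 𝔼 y' : Cube K,
        noiseCorr (fun k => (y k ^^ y' k)) (errorIndicator f P) (errorIndicator f P) := by
  simp only [← expect_embedCube_mul]
  calc _ = 𝔼 h : Fin n → Fin K, 𝔼 x, 𝔼 y : Cube K, 𝔼 y' : Cube K,
        errorIndicator f P (embedCube x h y) * errorIndicator f P (embedCube x h y') := by
        refine expect_congr rfl fun h _ => expect_congr rfl fun x _ => ?_
        rw [sq, errorFraction, expect_mul_expect]
    _ = 𝔼 h : Fin n → Fin K, 𝔼 y : Cube K, 𝔼 y' : Cube K, 𝔼 x,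
        errorIndicator f P (embedCube x h y) * errorIndicator f P (embedCube x h y') := by
        refine expect_congr rfl fun h _ => ?_
        rw [expect_comm]
        exact expect_congr rfl fun y _ => expect_comm _ _ _
    _ = _ := by
        rw [expect_comm]
        exact expect_congr rfl fun y _ => expect_comm _ _ _

/-- Decoding on random cubes of constant dimension makes the expected distance small, if the
distance is bounded away from half the minimum distance. -/
theorem expect_relDist_decodeStep_le_of_le {s : ℕ} (hs : 0 < s) (hK : K = s ^ 2)
    {t : LinTree (Cube K)} (ht : IsDecoder.{u} d K t) {P : Cube n → G}
    (hP : P ∈ juntaSum d (Fin n) G) {ε : ℝ} (hε : 0 < ε) {f : Cube n → G}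
    (hf : relDist f P ≤ 1 / 2 ^ (d + 1) - ε) :
    𝔼 h : Fin n → Fin K, relDist (decodeStep t h f) P ≤ 1 / (s * ε ^ 2) := by
  have hK0 : 0 < K := hK ▸ pow_pos hs 2
  have : Nonempty (Fin K) := ⟨⟨0, hK0⟩⟩
  set μ := relDist f P with hμ
  have hμ0 : 0 ≤ μ := by rw [hμ, relDist_eq_prob]; exact prob_nonneg _
  have hμ1 : μ ≤ 1 := by rw [hμ, relDist_eq_prob]; exact prob_le_one _
  have hs0 : (0 : ℝ) < s := by exact_mod_cast hs
  have hvar : 𝔼 h : Fin n → Fin K, 𝔼 x, (errorFraction f P x h - μ) ^ 2 ≤ 1 / s := by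
    have hmean : 𝔼 h : Fin n → Fin K, 𝔼 x, errorFraction f P x h = μ := by
      have : ∀ h : Fin n → Fin K, 𝔼 x, errorFraction f P x h = μ := by
        intro h
        unfold errorFraction
        rw [expect_comm]
        simp only [expect_embedCube, expect_errorIndicator, Fintype.expect_const, hμ]
      simp only [this, Fintype.expect_const]
    have hsq : ∀ (h : Fin n → Fin K) (x : Cube n), (errorFraction f P x h - μ) ^ 2 =
        errorFraction f P x h ^ 2 - 2 * μ * errorFraction f P x h + μ ^ 2 := by
      intro h x; ring
    have hN : ∀ y y' : Cube K,
        noiseCorr (fun k => (y k ^^ y' k)) (errorIndicator f P) (errorIndicator f P) ≤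
          μ ^ 2 + (1 / s + s * bias (fun k => (y k ^^ y' k)) ^ 2) / 2 := by
      intro y y'
      refine (noiseCorr_self_le _ _).trans ?_
      have e : 𝔼 x, errorIndicator f P x ^ 2 = μ := by
        rw [hμ, ← expect_errorIndicator]
        refine expect_congr rfl fun x _ => ?_
        rcases errorIndicator_eq_zero_or_one f P x with h | h <;> simp [h]
      rw [e, expect_errorIndicator, ← hμ]
      set ρ := bias fun k => (y k ^^ y' k)
      have h1 : |ρ| ≤ (1 / s + s * ρ ^ 2) / 2 := by
        have : 0 ≤ (1 - s * |ρ|) ^ 2 / s := by positivity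
        have h2 : (1 - s * |ρ|) ^ 2 / s = 1 / s + s * ρ ^ 2 - 2 * |ρ| := by
          rw [← sq_abs ρ]; field_simp; ring
        linarith
      have h2 : |ρ| * (μ - μ ^ 2) ≤ |ρ| * 1 :=
        mul_le_mul_of_nonneg_left (by nlinarith) (abs_nonneg _)
      linarith
    simp only [hsq, expect_add_distrib, expect_sub_distrib, ← mul_expect, hmean,
      Fintype.expect_const, expect_errorFraction_sq]
    have h3 : 𝔼 y : Cube K, 𝔼 y' : Cube K,
        noiseCorr (fun k => (y k ^^ y' k)) (errorIndicator f P) (errorIndicator f P) ≤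
        μ ^ 2 + 1 / s := by
      calc _ ≤ 𝔼 y : Cube K, 𝔼 y' : Cube K,
            (μ ^ 2 + (1 / s + s * bias (fun k => (y k ^^ y' k)) ^ 2) / 2) :=
            expect_le_expect fun y _ => expect_le_expect fun y' _ => hN y y'
        _ = μ ^ 2 + (1 / s + s * (1 / K)) / 2 := by
            simp only [expect_add_distrib, ← expect_div, ← mul_expect, Fintype.expect_const,
              expect_bias_sq hK0]
        _ = _ := by
            rw [hK]; push_cast; field_simp; ring
    linarith
  calc 𝔼 h : Fin n → Fin K, relDist (decodeStep t h f) P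
      ≤ 𝔼 h : Fin n → Fin K, (𝔼 x, (errorFraction f P x h - μ) ^ 2) / ε ^ 2 := by
        refine expect_le_expect fun h _ => (relDist_decodeStep_le ht hP f h).trans ?_
        refine (prob_mono fun x hx => ?_).trans
          (prob_le_expect_div (fun x => sq_nonneg (errorFraction f P x h - μ)) (by positivity))
        exact pow_le_pow_left₀ hε.le (by linarith) 2
    _ = (𝔼 h : Fin n → Fin K, 𝔼 x, (errorFraction f P x h - μ) ^ 2) / ε ^ 2 := by
        rw [expect_div]
    _ ≤ 1 / s / ε ^ 2 := by gcongr
    _ = _ := by rw [div_div]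

/-- Decoding on random cubes of a fixed dimension raises small distances to the power `3/2`, up to
a constant. -/
theorem expect_relDist_decodeStep_le (hK : 9 * 4 ^ (d + 1) < K)
    {t : LinTree (Cube K)} (ht : IsDecoder.{u} d K t) {P : Cube n → G}
    (hP : P ∈ juntaSum d (Fin n) G) (f : Cube n → G) :
    𝔼 h : Fin n → Fin K, relDist (decodeStep t h f) P ≤ 4 ^ K * fourthRoot (relDist f P) ^ 6 := by
  classical
  have hK0 : 0 < K := by omega
  have : Nonempty (Fin K) := ⟨⟨0, hK0⟩⟩
  set F := errorIndicator f P with hF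
  have hF01 : ∀ x, F x = 0 ∨ F x = 1 := errorIndicator_eq_zero_or_one f P
  have hF0 : ∀ x, 0 ≤ F x := fun x => by rcases hF01 x with h | h <;> simp [h]
  have hF1 : ∀ x, F x ≤ 1 := fun x => by rcases hF01 x with h | h <;> simp [h]
  set good : Finset (Cube K × Cube K) :=
    univ.filter fun p => |bias fun k => (p.1 k ^^ p.2 k)| ≤ 1 / 3 with hgood
  -- A failure requires two errors at a pair of bias at most `1/3`. Otherwise all pairs of errors
  -- have larger bias, and Chebyshev bounds the squared error fraction by `9 / K < 4^(-(d+1))`.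
  have hpoint : ∀ (h : Fin n → Fin K) (x : Cube n),
      (if 1 / 2 ^ (d + 1) ≤ errorFraction f P x h then (1 : ℝ) else 0) ≤
        ∑ p ∈ good, F (embedCube x h p.1) * F (embedCube x h p.2) := by
    intro h x
    have hnn : ∀ p ∈ good, 0 ≤ F (embedCube x h p.1) * F (embedCube x h p.2) :=
      fun p _ => mul_nonneg (hF0 _) (hF0 _)
    split_ifs with hx
    · by_contra hlt
      push Not at hlt
      have hzero : ∀ p ∈ good, F (embedCube x h p.1) * F (embedCube x h p.2) = 0 := by
        intro p hp
        have h1 := (single_le_sum hnn hp).trans_lt hlt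
        rcases hF01 (embedCube x h p.1) with h2 | h2
        · simp [h2]
        · rcases hF01 (embedCube x h p.2) with h3 | h3
          · simp [h3]
          · rw [h2, h3] at h1
            norm_num at h1
      have hsq : errorFraction f P x h ^ 2 ≤ 9 / K := by
        calc errorFraction f P x h ^ 2 = 𝔼 y : Cube K, 𝔼 y' : Cube K,
              F (embedCube x h y) * F (embedCube x h y') := by
              rw [sq, errorFraction, expect_mul_expect]
          _ ≤ 𝔼 y : Cube K, 𝔼 y' : Cube K, 9 * bias (fun k => (y k ^^ y' k)) ^ 2 := by
              refine expect_le_expect fun y _ => expect_le_expect fun y' _ => ?_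
              by_cases hg : |bias fun k => (y k ^^ y' k)| ≤ 1 / 3
              · rw [hzero (y, y') (by simpa [hgood] using hg)]
                positivity
              · push Not at hg
                have : (1 / 3) ^ 2 ≤ |bias fun k => (y k ^^ y' k)| ^ 2 := by gcongr
                rw [sq_abs] at this
                have := mul_le_one₀ (hF1 (embedCube x h y)) (hF0 _) (hF1 (embedCube x h y'))
                linarith
          _ = 9 / K := by
              simp only [← mul_expect, expect_bias_sq hK0]
              ring
      have h4 : (1 / 2 ^ (d + 1) : ℝ) ^ 2 ≤ 9 / K :=
        (pow_le_pow_left₀ (by positivity) hx 2).trans hsq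
      have h5 : ((9 * 4 ^ (d + 1) : ℕ) : ℝ) < K := by exact_mod_cast hK
      have h6 : (1 / 2 ^ (d + 1) : ℝ) ^ 2 = 1 / 4 ^ (d + 1) := by
        rw [div_pow, one_pow, ← pow_mul, mul_comm, pow_mul]; norm_num
      rw [h6, div_le_div_iff₀ (by positivity) (by exact_mod_cast hK0)] at h4
      push_cast at h5
      linarith
    · exact sum_nonneg hnn
  calc 𝔼 h : Fin n → Fin K, relDist (decodeStep t h f) P
      ≤ 𝔼 h : Fin n → Fin K, 𝔼 x, ∑ p ∈ good, F (embedCube x h p.1) * F (embedCube x h p.2) := by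
        refine expect_le_expect fun h _ => (relDist_decodeStep_le ht hP f h).trans ?_
        rw [prob_eq_expect]
        exact expect_le_expect fun x _ => hpoint h x
    _ = ∑ p ∈ good, noiseCorr (fun k => (p.1 k ^^ p.2 k)) F F := by
        simp only [expect_sum_comm, expect_embedCube_mul]
    _ ≤ ∑ p ∈ good, fourthRoot (relDist f P) ^ 6 := by
        refine sum_le_sum fun p hp => ?_
        refine (noiseCorr_le_of_small_bias (mem_filter.1 hp).2 hF01 hF01).trans (le_of_eq ?_)
        rw [hF, expect_errorIndicator]
        ring
    _ ≤ 4 ^ K * fourthRoot (relDist f P) ^ 6 := by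
        rw [sum_const, nsmul_eq_mul]
        have : good.card ≤ 4 ^ K := (card_le_univ _).trans (by
          simp [← mul_pow])
        gcongr
        exact_mod_cast this

end Step

/-! ### Iterated decoding and doubly exponential decay -/

section Iteration

variable {n K d q q' : ℕ} {G : Type u} [AddCommGroup G]

lemma LocallyComputable.mono {Φ : (Cube n → G) → G} (h : LocallyComputable q Φ) (hq : q ≤ q') :
    LocallyComputable q' Φ := by
  obtain ⟨h1, X, hX, h2⟩ := h
  exact ⟨h1, X, hX.trans hq, h2⟩

lemma LocallyComputable.comp_family {Φ : (Cube n → G) → G} {Ψ : Cube n → (Cube n → G) → G}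
    (hΦ : LocallyComputable q Φ) (hΨ : ∀ x, LocallyComputable q' (Ψ x)) :
    LocallyComputable (q * q') fun f => Φ fun x => Ψ x f := by
  obtain ⟨⟨t, ht⟩, X, hX, h2⟩ := hΦ
  simp only [funext ht] at h2 ⊢
  exact (LocallyComputable.comp t X hΨ h2).mono (Nat.mul_le_mul_right _ hX)

lemma locallyComputable_decodeStep (t : LinTree (Cube K)) (h : Fin n → Fin K) (x : Cube n) :
    LocallyComputable (2 ^ K) fun f : Cube n → G => decodeStep t h f x := by
  have := LocallyComputable.comp (G := G) t univ
    (fun y : Cube K => locallyComputable_apply (embedCube x h y)) (fun f g hfg => by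
      rw [show f = g from funext fun y => hfg y (by simp)])
  simpa [decodeStep] using this

/-- Iterated decoding on random cubes. -/
noncomputable def decodeIter (t : LinTree (Cube K)) :
    (m : ℕ) → (Fin m → Fin n → Fin K) → (Cube n → G) → Cube n → G
  | 0, _, f => f
  | m + 1, H, f => decodeIter t m (Fin.tail H) (decodeStep t (H 0) f)

lemma locallyComputable_decodeIter (t : LinTree (Cube K)) (m : ℕ) (H : Fin m → Fin n → Fin K)
    (x : Cube n) : LocallyComputable ((2 ^ K) ^ m) fun f : Cube n → G => decodeIter t m H f x := by
  induction m with
  | zero => simpa [decodeIter] using locallyComputable_apply x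
  | succ m ih =>
    rw [pow_succ]
    exact (ih (Fin.tail H)).comp_family fun z => locallyComputable_decodeStep t (H 0) z

/-- A union bound over rounds. Each round has a fresh map, and `hstep` holds for every function
within the current distance, so it applies whatever the earlier good choices were. -/
lemma prob_decodeIter_le {t : LinTree (Cube K)} {P : Cube n → G} {D φ : ℕ → ℝ}
    (hφ : ∀ i, 0 ≤ φ i) (hstep : ∀ i (f : Cube n → G), relDist f P ≤ D i →
      prob (fun h : Fin n → Fin K => D (i + 1) < relDist (decodeStep t h f) P) ≤ φ i)
    (m : ℕ) : ∀ (i : ℕ) (f : Cube n → G), relDist f P ≤ D i →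
      prob (fun H : Fin m → Fin n → Fin K => D (i + m) < relDist (decodeIter t m H f) P) ≤
        ∑ j ∈ range m, φ (i + j) := by
  induction m with
  | zero =>
    intro i f hf
    simp [prob, decodeIter, not_lt.2 hf]
  | succ m ih =>
    intro i f hf
    rw [prob_equiv (Fin.consEquiv fun _ => Fin n → Fin K).symm _
      (fun p => D (i + (m + 1)) < relDist (decodeIter t m p.2 (decodeStep t p.1 f)) P)
      (fun H => by simp [Fin.consEquiv, decodeIter]), sum_range_succ',
      add_comm (∑ k ∈ range m, φ (i + (k + 1)))]
    refine prob_prod_le _ (hstep i f hf) (sum_nonneg fun j _ => hφ _) fun h hh => ?_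
    have := ih (i + 1) (decodeStep t h f) (not_lt.1 hh)
    simpa only [add_assoc, add_comm 1, add_left_comm 1] using this

/-- The rate of the doubly exponential decay of the distance under iterated decoding. -/
noncomputable def decayRate (K : ℕ) : ℝ := 2 * K + 4

/-- The fourth root of a bound for the distance after `i` rounds of decoding. -/
noncomputable def decay (K i : ℕ) : ℝ := Real.exp (-(decayRate K * (5 / 4) ^ i))

/-- By Bernoulli the exponent is at least `2 * K + 4 + i`. Its three terms pay for `4 ^ K`, for `32`
and for `2 ^ i`, which makes the failure probabilities summable. -/
lemma four_pow_mul_decay_le (K i : ℕ) : 4 ^ K * decay K i ≤ (1 / 2) ^ i / 32 := by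
  have h1 : (1 + i / 4 : ℝ) ≤ (5 / 4) ^ i := by
    have := one_add_mul_le_pow (a := (1 / 4 : ℝ)) (by norm_num) i
    calc (1 + i / 4 : ℝ) = 1 + i * (1 / 4) := by ring
      _ ≤ _ := this
      _ = _ := by norm_num
  have hK : (0 : ℝ) ≤ K := Nat.cast_nonneg K
  have hi : (0 : ℝ) ≤ i := Nat.cast_nonneg i
  have h2 : -(decayRate K * (5 / 4) ^ i) ≤ -(K * 2) + -4 + -i := by
    have : decayRate K * (1 + i / 4) ≤ decayRate K * (5 / 4) ^ i := by
      unfold decayRate; gcongr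
    unfold decayRate at this ⊢
    nlinarith [mul_nonneg hK hi]
  have e1 : (2 : ℝ) ≤ Real.exp 1 := by have := Real.exp_one_gt_d9; linarith
  have h3 : Real.exp (-(K * 2)) ≤ (1 / 4) ^ K := by
    rw [show -(K * 2 : ℝ) = -2 * K by ring]
    calc Real.exp (-2 * K) = Real.exp (-2) ^ K := by rw [← Real.exp_nat_mul, mul_comm]
      _ ≤ (1 / 4) ^ K := by
        gcongr
        rw [Real.exp_neg, one_div]
        gcongr
        calc (4 : ℝ) = 2 ^ 2 := by norm_num
          _ ≤ Real.exp 1 ^ 2 := by gcongr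
          _ = Real.exp 2 := by rw [← Real.exp_nat_mul]; norm_num
  have h4 : Real.exp (-4) ≤ 1 / 32 := by
    rw [Real.exp_neg, one_div]
    gcongr
    calc (32 : ℝ) ≤ 2.7 ^ 4 := by norm_num
      _ ≤ Real.exp 1 ^ 4 := by
        gcongr
        have := Real.exp_one_gt_d9
        linarith
      _ = Real.exp 4 := by rw [← Real.exp_nat_mul]; norm_num
  have h5 : Real.exp (-i) ≤ (1 / 2) ^ i := by
    calc Real.exp (-i) = Real.exp (-1) ^ i := by rw [← Real.exp_nat_mul]; congr 1; ring
      _ ≤ _ := by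
        gcongr
        rw [Real.exp_neg, one_div]
        gcongr
  calc 4 ^ K * decay K i ≤ 4 ^ K * Real.exp (-(K * 2) + -4 + -i) := by
        unfold decay; gcongr
    _ = 4 ^ K * (Real.exp (-(K * 2)) * Real.exp (-4) * Real.exp (-i)) := by
        rw [Real.exp_add, Real.exp_add]
    _ ≤ 4 ^ K * ((1 / 4) ^ K * (1 / 32) * (1 / 2) ^ i) := by gcongr
    _ = _ := by rw [← mul_assoc, ← mul_assoc, ← mul_pow]; norm_num; ring

lemma fourthRoot_pow_four {a : ℝ} (ha : 0 ≤ a) : fourthRoot (a ^ 4) = a := by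
  rw [fourthRoot, show a ^ 4 = (a ^ 2) ^ 2 by ring, Real.sqrt_sq (by positivity), Real.sqrt_sq ha]

/-- Iterated decoding makes a small constant distance tiny. -/
theorem prob_decodeIter_le_of_le (hK : 9 * 4 ^ (d + 1) < K)
    {t : LinTree (Cube K)} (ht : IsDecoder.{u} d K t) {P : Cube n → G}
    (hP : P ∈ juntaSum d (Fin n) G) (m : ℕ) {f : Cube n → G} (hf : relDist f P ≤ decay K 0 ^ 4) :
    prob (fun H : Fin m → Fin n → Fin K => decay K m ^ 4 < relDist (decodeIter t m H f) P) ≤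
      1 / 16 := by
  have hpos : ∀ i, 0 < decay K i := fun i => Real.exp_pos _
  have hsucc : ∀ i, decay K (i + 1) ^ 4 = decay K i ^ 5 := by
    intro i
    rw [decay, decay, ← Real.exp_nat_mul, ← Real.exp_nat_mul]
    congr 1
    push_cast
    ring
  have h1 := prob_decodeIter_le (t := t) (P := P) (D := fun i => decay K i ^ 4)
    (φ := fun i => 4 ^ K * decay K i) (fun i => by have := hpos i; positivity) ?_ m 0 f hf
  · simp only [zero_add] at h1
    refine h1.trans ?_
    calc ∑ j ∈ range m, 4 ^ K * decay K j ≤ ∑ j ∈ range m, (1 / 2 : ℝ) ^ j / 32 :=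
          sum_le_sum fun j _ => four_pow_mul_decay_le K j
      _ = (∑ j ∈ range m, (1 / 2 : ℝ) ^ j) / 32 := by rw [sum_div]
      _ ≤ 2 / 32 := by
          gcongr
          exact sum_geometric_two_le m
      _ = 1 / 16 := by norm_num
  · intro i f hf
    refine (prob_mono fun h hh => le_of_lt hh).trans ((prob_le_expect_div (fun h => ?_) ?_).trans ?_)
    · exact relDist_nonneg _ _
    · exact pow_pos (hpos _) 4
    -- The expected new distance is at most `4 ^ K * decay K i ^ 6`, while the next target is `decay
    -- K i ^ 5`. Markov's inequality costs one power of `decay K i`.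
    · rw [div_le_iff₀ (pow_pos (hpos _) 4), hsucc]
      calc _ ≤ 4 ^ K * fourthRoot (relDist f P) ^ 6 := expect_relDist_decodeStep_le hK ht hP f
        _ ≤ 4 ^ K * fourthRoot (decay K i ^ 4) ^ 6 := by
            gcongr
            · exact fourthRoot_nonneg _
            · exact fourthRoot_mono hf
        _ = _ := by rw [fourthRoot_pow_four (hpos i).le]; ring

end Iteration

/-! ### Assembling the algorithm -/

lemma hasLocalCorrection_of_prob {n q : ℕ} {G : Type u} [AddCommGroup G] {F : Set (Cube n → G)}
    {δ : ℝ} {Ω : Type} [Fintype Ω] [Nonempty Ω] (Φ : Cube n → Ω → (Cube n → G) → G)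
    (hΦ : ∀ a ω, LocallyComputable q (Φ a ω))
    (h : ∀ f, ∀ P ∈ F, relDist f P ≤ δ → ∀ a, prob (fun ω => Φ a ω f ≠ P a) ≤ 1 / 4) :
    HasLocalCorrection F δ q := by
  classical
  choose prog hq hprog using fun a ω => (hΦ a ω).exists_program
  refine ⟨fun a => (PMF.uniformOfFintype Ω).map (prog a), ?_, ?_⟩
  · intro a p hp
    rw [PMF.mem_support_map_iff] at hp
    obtain ⟨ω, _, rfl⟩ := hp
    exact hq a ω
  · intro f P hP hfP a
    have h1 := h f P hP hfP a
    rw [prob_not] at h1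
    have hs : (OracleProgram.run f ∘ prog a) ⁻¹' {P a} = {ω | Φ a ω f = P a} := by
      ext ω
      simp [hprog]
    rw [PMF.map_comp, ← PMF.toOuterMeasure_apply_singleton, PMF.toOuterMeasure_map_apply, hs,
      PMF.toOuterMeasure_uniformOfFintype_apply]
    have h2 : (3 / 4 : ℝ) ≤ prob fun ω => Φ a ω f = P a := by linarith
    have e : Fintype.card {ω | Φ a ω f = P a} = {ω | Φ a ω f = P a}.ncard := by
      rw [Set.ncard_eq_toFinset_card', Set.toFinset_card]
    rw [e]
    have hc : (0 : ℝ) < Fintype.card Ω := by exact_mod_cast Fintype.card_pos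
    rw [prob, le_div_iff₀ hc] at h2
    rw [ENNReal.le_div_iff_mul_le (Or.inl (by simp)) (Or.inl (by simp)),
      ← ENNReal.mul_div_right_comm]
    refine ENNReal.div_le_of_le_mul ?_
    have h3 : 3 * Fintype.card Ω ≤ {ω | Φ a ω f = P a}.ncard * 4 := by
      have : (3 * Fintype.card Ω : ℝ) ≤ {ω | Φ a ω f = P a}.ncard * 4 := by linarith
      exact_mod_cast this
    exact_mod_cast h3

/-- The local correction algorithm, with its parameters: `2^r` is at least the dimension, `m` bounds
the number of points of the interpolation, and `T` is the number of rounds of error reduction. -/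
theorem exists_hasLocalCorrection (d : ℕ) {ε : ℝ} (hε : 0 < ε) :
    ∃ K B : ℕ, ∀ (G : Type u) [AddCommGroup G] (n r T m : ℕ), 0 < r → n ≤ 2 ^ r →
      (∀ k : ℕ, 2 ^ k ≤ (k + 1) ^ (4 * (d + 1) * (r + 1)) ^ d → k ≤ m) →
      (24 * m : ℝ) ≤ Real.exp ((5 / 4) ^ T) →
      HasLocalCorrection (polySpace d n G) (1 / 2 ^ (d + 1) - ε) (m * ((2 ^ K) ^ T * B)) := by
  classical
  set K := 9 * 4 ^ (d + 1) + 1 with hK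
  have hD0 : 0 < decay K 0 := Real.exp_pos _
  -- Makes `1 / (s * ε ^ 2)` at most a sixteenth of the distance at which the iteration may start.
  obtain ⟨s, hs⟩ := exists_nat_gt (16 / (ε ^ 2 * decay K 0 ^ 4))
  have hs0 : (0 : ℝ) < s := lt_trans (by positivity) hs
  have hs0' : 0 < s := by exact_mod_cast hs0
  obtain ⟨tA, htA⟩ := exists_decoder.{u} d (pow_pos hs0' 2)
  obtain ⟨tB, htB⟩ := exists_decoder.{u} d (show 0 < K by omega)
  refine ⟨K, 2 ^ s ^ 2, fun G _ n r T m hr hn hm hT => ?_⟩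
  obtain ⟨S, hS, hbal, c, hc⟩ := exists_balanced_interpolation.{u} d hr
  have hSm : S.card ≤ m := hm _ hS
  have : Nonempty (Fin (s ^ 2)) := ⟨⟨0, pow_pos hs0' 2⟩⟩
  have : Nonempty (Fin K) := ⟨⟨0, by omega⟩⟩
  have : Nonempty (WeightedCoord d r) := ⟨⟨(0, 0), ⟨0, by simp⟩⟩⟩
  refine hasLocalCorrection_of_prob
    (Ω := (Fin n → Fin (s ^ 2)) × (Fin T → Fin n → Fin K) × (Fin n → WeightedCoord d r))
    (fun a ω f => ∑ y ∈ S, c y •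
      decodeIter tB T ω.2.1 (decodeStep tA ω.1 f) (embedCube a (Sigma.fst ∘ ω.2.2) y)) ?_ ?_
  · intro a ω
    have h1 : LocallyComputable m fun f : Cube n → G =>
        ∑ y ∈ S, c y • f (embedCube a (Sigma.fst ∘ ω.2.2) y) := by
      have := LocallyComputable.comp (G := G)
        (.output fun y : Coord d r → Bool => if y ∈ S then c y else 0) S
        (fun y => locallyComputable_apply (embedCube a (Sigma.fst ∘ ω.2.2) y)) (by
          intro f g hfg
          simp only [LinTree.eval, ite_smul, zero_smul, sum_ite_mem, univ_inter]
          exact sum_congr rfl fun y hy => by rw [hfg y (by simpa using hy)])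
      simp only [LinTree.eval, ite_smul, zero_smul, sum_ite_mem, univ_inter] at this
      exact this.mono (by simpa using hSm)
    exact h1.comp_family fun x => (locallyComputable_decodeIter tB T ω.2.1 x).comp_family
      fun z => locallyComputable_decodeStep tA ω.1 z
  · intro f P hP hfP a
    have hPj := polySpace_subset_juntaSum hP
    -- Error budget: the initial round, the iterated rounds, and the union bound over the
    -- interpolation points.
    rw [show (1 / 4 : ℝ) = 1 / 16 + (1 / 16 + 1 / 8) by norm_num]
    refine prob_prod_le (fun hA => decay K 0 ^ 4 < relDist (decodeStep tA hA f) P) ?_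
      (by norm_num) fun hA hgA => ?_
    · refine (prob_mono fun h hh => le_of_lt hh).trans
        ((prob_le_expect_div (fun h => ?_) (pow_pos hD0 4)).trans ?_)
      · rw [relDist_eq_prob]; exact prob_nonneg _
      · rw [div_le_iff₀ (pow_pos hD0 4)]
        refine (expect_relDist_decodeStep_le_of_le hs0' rfl htA hPj hε hfP).trans ?_
        rw [div_lt_iff₀ (by positivity)] at hs
        rw [div_le_iff₀ (by positivity)]
        linarith
    · refine prob_prod_le
        (fun H => decay K T ^ 4 < relDist (decodeIter tB T H (decodeStep tA hA f)) P)
        (prob_decodeIter_le_of_le (by omega) htB hPj T (not_lt.1 hgA)) (by norm_num)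
        fun H hgH => ?_
      set f' := decodeIter tB T H (decodeStep tA hA f) with hf'
      calc prob (fun h : Fin n → WeightedCoord d r =>
            ∑ y ∈ S, c y • f' (embedCube a (Sigma.fst ∘ h) y) ≠ P a)
          ≤ prob (fun h : Fin n → WeightedCoord d r =>
            ∃ y ∈ S, f' (embedCube a (Sigma.fst ∘ h) y) ≠ P (embedCube a (Sigma.fst ∘ h) y)) := by
            refine prob_mono fun h hne => ?_
            by_contra hcon
            push Not at hcon
            refine hne ?_
            rw [sum_congr rfl fun y hy => by rw [hcon y hy],
              hc G (fun y => P (embedCube a (Sigma.fst ∘ h) y)) (juntaSum_embedCube hPj _ _),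
              embedCube_false]
        _ ≤ ∑ y ∈ S, 3 * relDist f' P := by
            refine (prob_exists_le _ _).trans (sum_le_sum fun y hy => ?_)
            rw [relDist_eq_prob]
            exact prob_embedCube_le hn (hbal y hy).1 (hbal y hy).2 a fun x => f' x ≠ P x
        _ ≤ m * (3 * decay K T ^ 4) := by
            rw [sum_const, nsmul_eq_mul]
            have := not_lt.1 hgH
            have := relDist_nonneg f' P
            gcongr
        _ ≤ m * (3 * Real.exp (-(5 / 4) ^ T)) := by
            gcongr
            rw [decay, ← Real.exp_nat_mul]
            refine Real.exp_le_exp.2 ?_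
            have h1 : (0 : ℝ) ≤ (5 / 4) ^ T := by positivity
            have h2 : (0 : ℝ) ≤ K * (5 / 4) ^ T := by positivity
            unfold decayRate
            push_cast
            nlinarith
        _ ≤ 1 / 8 := by
            rw [Real.exp_neg]
            have := Real.exp_pos ((5 / 4) ^ T)
            rw [← mul_assoc, mul_inv_le_iff₀ this]
            linarith

/-! ### Choice of parameters and the query bound -/

section Asymptotics

/-- Bound `log (k + 1)` by its tangent at `4 * D`: this costs only `k / 4` against `k * log 2`, and
`1 / (0.69 - 0.25) < 3`. -/
lemma le_of_two_pow_le {k D : ℕ} (hD : 1 ≤ D) (h : 2 ^ k ≤ (k + 1) ^ D) :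
    (k : ℝ) ≤ 3 * D * Real.log (4 * D) := by
  have hD' : (1 : ℝ) ≤ D := by exact_mod_cast hD
  have h1 : (k : ℝ) * Real.log 2 ≤ D * Real.log (k + 1) := by
    rw [← Real.log_pow, ← Real.log_pow]
    exact Real.log_le_log (by positivity) (by exact_mod_cast h)
  have h2 : Real.log (k + 1) ≤ Real.log (4 * D) + ((k + 1) / (4 * D) - 1) := by
    have := Real.log_le_sub_one_of_pos (show (0 : ℝ) < (k + 1) / (4 * D) by positivity)
    rw [Real.log_div (by positivity) (by positivity)] at this
    linarith
  have h3 : D * Real.log (k + 1) ≤ D * Real.log (4 * D) + k / 4 := by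
    calc D * Real.log (k + 1) ≤ D * (Real.log (4 * D) + ((k + 1) / (4 * D) - 1)) := by gcongr
      _ = D * Real.log (4 * D) + (k + 1) / 4 - D := by field_simp; ring
      _ ≤ _ := by linarith
  have h4 : (k : ℝ) * 0.69 ≤ k * Real.log 2 := by
    have := Real.log_two_gt_d9
    gcongr
    linarith
  have hk : (0 : ℝ) ≤ k := Nat.cast_nonneg k
  linarith

lemma two_pow_clog_le {x : ℕ} (hx : 0 < x) : 2 ^ Nat.clog 2 x ≤ 2 * x := by
  rcases Nat.lt_or_ge 1 x with h | h
  · have h1 := Nat.pow_pred_clog_lt_self one_lt_two h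
    have h2 : 0 < Nat.clog 2 x := Nat.clog_pos one_lt_two h
    obtain ⟨m, hm⟩ := Nat.exists_eq_succ_of_ne_zero h2.ne'
    rw [hm] at h1 ⊢
    rw [Nat.pred_succ] at h1
    rw [Nat.succ_eq_add_one, pow_succ]
    omega
  · have : x = 1 := by omega
    subst this
    simp

lemma clog_le_log {x : ℕ} (hx : 0 < x) : (Nat.clog 2 x : ℝ) ≤ 1 + 1.5 * Real.log x := by
  have hx' : (0 : ℝ) < x := by exact_mod_cast hx
  have h1 : (2 : ℝ) ^ Nat.clog 2 x ≤ 2 * x := by exact_mod_cast two_pow_clog_le hx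
  have h2 := Real.log_le_log (by positivity) h1
  rw [Real.log_pow, Real.log_mul (by norm_num) hx'.ne'] at h2
  have h3 := Real.log_two_gt_d9
  have h4 : 0 ≤ Real.log x := Real.log_natCast_nonneg x
  nlinarith

/-- The number of rounds of error reduction that makes the distance smaller than `1/m`. -/
def roundCount (m : ℕ) : ℕ := 4 * Nat.clog 2 (Nat.clog 2 (24 * m + 2))

lemma le_exp_roundCount (m : ℕ) : (24 * m : ℝ) ≤ Real.exp ((5 / 4) ^ roundCount m) := by
  set Y := Nat.clog 2 (24 * m + 2) with hY
  have h1 : (24 * m + 2 : ℝ) ≤ 2 ^ Y := by exact_mod_cast Nat.le_pow_clog one_lt_two _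
  have h2 : (Y : ℝ) ≤ 2 ^ Nat.clog 2 Y := by exact_mod_cast Nat.le_pow_clog one_lt_two _
  -- The factor `4` in `roundCount` is explained by `(5 / 4) ^ 4 ≥ 2`.
  have h3 : (2 : ℝ) ^ Nat.clog 2 Y ≤ (5 / 4) ^ roundCount m := by
    rw [roundCount, pow_mul]
    gcongr
    norm_num
  calc (24 * m : ℝ) ≤ 2 ^ Y := by linarith
    _ ≤ Real.exp 1 ^ Y := by
      gcongr
      have := Real.exp_one_gt_d9
      linarith
    _ = Real.exp Y := by rw [← Real.exp_nat_mul, mul_one]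
    _ ≤ _ := Real.exp_le_exp.2 (h2.trans h3)

lemma two_pow_roundCount_le (m : ℕ) :
    (2 : ℝ) ^ roundCount m ≤ (4 + 3 * Real.log (24 * m + 2)) ^ 4 := by
  set Y := Nat.clog 2 (24 * m + 2) with hY
  have hYpos : 0 < Y := Nat.clog_pos one_lt_two (by omega)
  have h1 : (2 : ℝ) ^ Nat.clog 2 Y ≤ 2 * Y := by exact_mod_cast two_pow_clog_le hYpos
  have h2 := clog_le_log (x := 24 * m + 2) (by omega)
  rw [← hY] at h2
  push_cast at h2
  rw [roundCount, ← hY, mul_comm, pow_mul]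
  gcongr
  linarith

/-- Local correction with a quasi-optimal number of queries, for a single degree. -/
theorem exists_query_bound (d : ℕ) {ε : ℝ} (hε : 0 < ε) :
    ∃ (C : ℝ) (c : ℕ) (q : ℕ → ℕ), 0 ≤ C ∧
      (∀ n : ℕ, 2 ≤ n →
        (q n : ℝ) ≤ C * (Real.log n) ^ d * (Real.log (2 + (Real.log n) ^ d)) ^ c) ∧
      ∀ (G : Type u) [AddCommGroup G] (n : ℕ),
        HasLocalCorrection (polySpace d n G) (1 / 2 ^ (d + 1) - ε) (q n) := by
  obtain ⟨K, B, hKB⟩ := exists_hasLocalCorrection.{u} d hε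
  set dim : ℕ → ℕ := fun n => (4 * (d + 1) * (Nat.clog 2 n + 1 + 1)) ^ d with hdim
  have hdim1 : ∀ n, 1 ≤ dim n := fun n => Nat.one_le_pow _ _ (by positivity)
  set m : ℕ → ℕ := fun n => ⌊3 * dim n * Real.log (4 * dim n)⌋₊ with hm
  set A : ℝ := (24 * (d + 1)) ^ d with hA
  have hA1 : 1 ≤ A := one_le_pow₀ (by have : (0 : ℝ) ≤ d := Nat.cast_nonneg d; linarith)
  have hlogA : 0 ≤ Real.log (4 * A) := Real.log_nonneg (by linarith)
  set A' : ℝ := 2 * Real.log (4 * A) + 1 with hA'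
  have hA'0 : 0 ≤ A' := by linarith
  -- The interpolation points contribute `3 * A * A'` and one factor `X`; the rounds contribute
  -- `((44 + 6 * A') * X) ^ (4 * K)`.
  refine ⟨3 * A * A' * ((44 + 6 * A') ^ 4) ^ K * B, 4 * K + 1,
    fun n => m n * ((2 ^ K) ^ roundCount (m n) * B), by positivity, fun n hn => ?_,
    fun G _ n => ?_⟩
  · have hn' : (2 : ℝ) ≤ n := by exact_mod_cast hn
    have hl2 := Real.log_two_gt_d9
    have hl : 0.69 ≤ Real.log n := by
      have := Real.log_le_log (by norm_num) hn'
      linarith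
    have hl0 : 0 ≤ Real.log n := by linarith
    set L := Real.log n ^ d with hL
    have hL0 : 0 ≤ L := by positivity
    set X := Real.log (2 + L) with hX
    have hX1 : 1 / 2 ≤ X := by
      have := Real.log_le_log (by norm_num) (show (2 : ℝ) ≤ 2 + L by linarith)
      linarith
    have hDL : (dim n : ℝ) ≤ A * L := by
      rw [hdim, hA, hL, ← mul_pow]
      push_cast
      refine pow_le_pow_left₀ (by positivity) ?_ _
      have h1 := clog_le_log (x := n) (by omega)
      calc (4 * (d + 1) * (Nat.clog 2 n + 1 + 1) : ℝ) ≤ 4 * (d + 1) * (6 * Real.log n) := by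
            gcongr
            linarith
        _ = _ := by ring
    have hD1 : (1 : ℝ) ≤ dim n := by exact_mod_cast hdim1 n
    have hlogD0 : 0 ≤ Real.log (4 * dim n) := Real.log_nonneg (by linarith)
    have hlogD : Real.log (4 * dim n) ≤ A' * X := by
      calc Real.log (4 * dim n) ≤ Real.log (4 * A * (2 + L)) :=
            Real.log_le_log (by positivity) (by nlinarith)
        _ = Real.log (4 * A) + X := by rw [Real.log_mul (by positivity) (by positivity)]
        _ ≤ A' * X := by rw [hA']; nlinarith
    have hmD : (m n : ℝ) ≤ 3 * dim n * Real.log (4 * dim n) := Nat.floor_le (by positivity)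
    have hm1 : (m n : ℝ) ≤ 3 * A * A' * (L * X) := by
      calc (m n : ℝ) ≤ 3 * dim n * Real.log (4 * dim n) := hmD
        _ ≤ 3 * (A * L) * (A' * X) := by gcongr
        _ = _ := by ring
    have hm2 : Real.log (24 * m n + 2) ≤ (12 + 2 * A') * X := by
      have h1 : (24 * m n + 2 : ℝ) ≤ Real.exp 6 * (4 * dim n) ^ 2 := by
        have h2 : Real.log (4 * dim n) ≤ 4 * dim n := Real.log_le_self (by positivity)
        have h3 : (32 : ℝ) ≤ Real.exp 6 := by
          calc (32 : ℝ) ≤ 2 ^ 6 := by norm_num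
            _ ≤ Real.exp 1 ^ 6 := by
              gcongr
              have := Real.exp_one_gt_d9
              linarith
            _ = Real.exp 6 := by rw [← Real.exp_nat_mul]; norm_num
        calc (24 * m n + 2 : ℝ) ≤ 24 * (3 * dim n * (4 * dim n)) + 2 := by
              have : 3 * dim n * Real.log (4 * dim n) ≤ 3 * dim n * (4 * dim n) := by gcongr
              linarith
          _ ≤ 32 * (4 * dim n) ^ 2 := by nlinarith
          _ ≤ _ := by gcongr
      calc Real.log (24 * m n + 2) ≤ Real.log (Real.exp 6 * (4 * dim n) ^ 2) :=
            Real.log_le_log (by positivity) h1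
        _ = 6 + 2 * Real.log (4 * dim n) := by
            rw [Real.log_mul (by positivity) (by positivity), Real.log_exp, Real.log_pow]
            norm_num
        _ ≤ _ := by nlinarith
    have hpow : (2 : ℝ) ^ roundCount (m n) ≤ ((44 + 6 * A') * X) ^ 4 := by
      refine (two_pow_roundCount_le (m n)).trans ?_
      have : 0 ≤ Real.log (24 * m n + 2) :=
        Real.log_nonneg (by have : (0 : ℝ) ≤ m n := Nat.cast_nonneg _; linarith)
      gcongr
      nlinarith
    have hX0 : 0 ≤ X := by linarith
    push_cast
    calc (m n : ℝ) * ((2 ^ K) ^ roundCount (m n) * B)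
        = m n * ((2 ^ roundCount (m n)) ^ K * B) := by
          rw [← pow_mul, ← pow_mul, mul_comm K]
      _ ≤ 3 * A * A' * (L * X) * ((((44 + 6 * A') * X) ^ 4) ^ K * B) := by gcongr
      _ = _ := by
          rw [mul_pow, mul_pow, ← pow_mul X, pow_succ]
          ring
  -- The extra one keeps `r` positive for `n ≤ 1`.
  · refine hKB G n (Nat.clog 2 n + 1) _ _ (Nat.succ_pos _) ?_ ?_ (le_exp_roundCount _)
    · exact (Nat.le_pow_clog one_lt_two n).trans
        (Nat.pow_le_pow_right two_pos (Nat.le_succ _))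
    · intro k hk
      exact Nat.le_floor (le_of_two_pow_le (hdim1 n) hk)

lemma hasLocalCorrection_of_neg {n q : ℕ} {G : Type*} [AddCommGroup G] (F : Set (Cube n → G))
    {δ : ℝ} (hδ : δ < 0) : HasLocalCorrection F δ q :=
  ⟨fun _ => PMF.pure (.output Fin.elim0), fun _ p hp => by
    rw [PMF.mem_support_pure_iff] at hp
    simp [hp, OracleProgram.queries],
    fun f P _ h => absurd (h.trans_lt hδ) (not_lt.2 (relDist_nonneg f P))⟩

end Asymptotics

end LocalCorrection

/-- Constants independent of `d` are possible because, once `2^(-d₀) < ε`, the radius is negative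
for all `d ≥ d₀` and no queries are needed. Only finitely many degrees remain, and their constants
are added up. -/
theorem theorem1p1 (ε : ℝ) (hε : 0 < ε) :
    ∃ (C : ℝ) (c : ℕ), ∀ d : ℕ, ∃ q : ℕ → ℕ,
      (∀ n : ℕ, 2 ≤ n →
        (q n : ℝ) ≤ C * (Real.log n) ^ d * (Real.log (2 + (Real.log n) ^ d)) ^ c) ∧
      ∀ (G : Type*) [AddCommGroup G] (n : ℕ),
        LocalCorrection.HasLocalCorrection (LocalCorrection.polySpace d n G)
          (1 / 2 ^ (d + 1) - ε) (q n) := by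
  choose C c q hC hq hcorr using fun d => LocalCorrection.exists_query_bound d hε
  obtain ⟨d₀, hd₀⟩ := exists_pow_lt_of_lt_one hε (show (1 / 2 : ℝ) < 1 by norm_num)
  set c₀ := ∑ d ∈ Finset.range d₀, c d with hc₀
  have hC0 : 0 ≤ ∑ d ∈ Finset.range d₀, C d * 2 ^ c₀ :=
    Finset.sum_nonneg fun d _ => mul_nonneg (hC d) (by positivity)
  refine ⟨∑ d ∈ Finset.range d₀, C d * 2 ^ c₀, c₀, fun d => ?_⟩
  have hlog : ∀ n : ℕ, 0 ≤ Real.log n := Real.log_natCast_nonneg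
  have hX : ∀ n : ℕ, 1 / 2 ≤ Real.log (2 + Real.log n ^ d) := fun n => by
    have h1 := Real.log_two_gt_d9
    have h2 : 0 ≤ Real.log n ^ d := pow_nonneg (hlog n) d
    have := Real.log_le_log (by norm_num) (show (2 : ℝ) ≤ 2 + Real.log n ^ d by linarith)
    linarith
  by_cases hd : d < d₀
  · refine ⟨q d, fun n hn => (hq d n hn).trans ?_, fun G _ n => hcorr d G n⟩
    have hcd : c d ≤ c₀ := Finset.single_le_sum (fun _ _ => Nat.zero_le _) (Finset.mem_range.2 hd)
    have hCd : C d * 2 ^ c₀ ≤ ∑ d ∈ Finset.range d₀, C d * 2 ^ c₀ :=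
      Finset.single_le_sum (f := fun d => C d * 2 ^ c₀)
        (fun d _ => mul_nonneg (hC d) (by positivity)) (Finset.mem_range.2 hd)
    have hL : 0 ≤ Real.log n ^ d := pow_nonneg (hlog n) d
    set X := Real.log (2 + Real.log n ^ d)
    have hX0 : 0 ≤ X := by linarith [hX n]
    -- `X` may be less than one, so raising its exponent uses `2 * X ≥ 1` and costs a power of two.
    have hXc : X ^ c d ≤ 2 ^ c₀ * X ^ c₀ := by
      obtain ⟨e, he⟩ := Nat.exists_eq_add_of_le hcd
      calc X ^ c d ≤ X ^ c d * (2 * X) ^ e :=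
            le_mul_of_one_le_right (by positivity) (one_le_pow₀ (by linarith [hX n]))
        _ = 1 * (2 ^ e * X ^ c₀) := by rw [he, mul_pow]; ring
        _ ≤ 2 ^ c d * (2 ^ e * X ^ c₀) := by
            gcongr
            exact one_le_pow₀ (by norm_num)
        _ = _ := by rw [he]; ring
    calc C d * Real.log n ^ d * X ^ c d ≤ C d * Real.log n ^ d * (2 ^ c₀ * X ^ c₀) := by
          have := hC d
          gcongr
      _ = C d * 2 ^ c₀ * Real.log n ^ d * X ^ c₀ := by ring
      _ ≤ _ := by gcongr
  · refine ⟨0, fun n _ => ?_, fun G _ n => LocalCorrection.hasLocalCorrection_of_neg _ ?_⟩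
    · have := hX n
      have := hlog n
      simp only [Pi.zero_apply, Nat.cast_zero]
      positivity
    · have h1 : (1 / 2 : ℝ) ^ (d + 1) ≤ (1 / 2) ^ d₀ :=
        pow_le_pow_of_le_one (by norm_num) (by norm_num) (by omega)
      rw [div_pow, one_pow] at h1
      linarith
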